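/- \textbf{Conventions.} Manifolds are smooth, Hausdorff and second countable; their components may have different dimensions. An \emph{orbifold groupoid} is a proper \'etale Lie groupoid $\mathcal G$ with objects $G_0$, arrows $G_1$, source and target $s,t$, isotropy groups $G_x$ $(x\in G_0)$ and orbit space $|\mathcal G|$. A \emph{homomorphism} $\Phi:\mathcal G\to\mathcal H$ of Lie groupoids is a functor whose maps $\Phi_0$ on objects and $\Phi_1$ on arrows are smooth. It is a \emph{strong equivalence} if $\Phi_0$ is a surjective submersion and the square formed by $\Phi_1$, $\Phi_0\times\Phi_0$ and the two maps $(s,t)$ is a fibred product of manifolds; it is an \emph{equivalence} if that square is a fibred product of manifolds and $t\circ\mathrm{pr}_1:H_1\times_{s,H_0,\Phi_0}G_0\to H_0$ is a surjective submersion. Orbifold groupoids $\mathcal G,\mathcal H$ are \emph{Morita equivalent}, i.e. present the same orbifold, if there are an orbifold groupoid $\mathcal K$ and equivalences $\mathcal G\leftarrow\mathcal K\to\mathcal H$. Let $\Gamma$ be a finitely generated group and $\mathcal G$ an orbifold groupoid. Put $\mathcal S^\Gamma_{\mathcal G}=\bigcup_{x\in G_0}\mathrm{Hom}(\Gamma,G_x)$.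 A linear chart at $x\in G_0$ is a neighbourhood $V_x$ of $x$ with a diffeomorphism $V_x\cong\mathbb R^n$ taking $x$ to $0$, a linear representation of $G_x$ on $\mathbb R^n$, and an identification of $\mathcal G|_{V_x}$ with the corresponding action groupoid $G_x\ltimes V_x$ that is the identity on $G_x$ and is given by a homomorphism $\xi_x:\mathcal G|_{V_x}\to G_x$. For $\phi\in\mathrm{Hom}(\Gamma,G_x)$ let $V_x^{\langle\phi\rangle}$ be the fixed-point set of $\phi(\Gamma)$, and let $\kappa_\phi:V_x^{\langle\phi\rangle}\to\mathcal S^\Gamma_{\mathcal G}$, $\kappa_\phi(y)=(\xi_x|_{G_y})^{-1}\circ\phi$. Give $\mathcal S^\Gamma_{\mathcal G}$ the topology and the smooth charts determined by all the maps $\kappa_\phi$. Arrows $g:x\to y$ act by $\mathrm{Hom}(\Gamma,G_x)\to\mathrm{Hom}(\Gamma,G_y)$, $(g\phi)(\gamma)=g\phi(\gamma)g^{-1}$, and $\mathcal G^\Gamma=\mathcal G\ltimes\mathcal S^\Gamma_{\mathcal G}$ is the action groupoid, with arrows $(g,\phi):\phi\to g\phi$ for $\phi\in\mathrm{Hom}(\Gamma,G_{s(g)})$.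 Its orbit space with the orbifold structure given by $\mathcal G^\Gamma$ is the space of $\Gamma$-sectors $\tilde Q_\Gamma$ of the orbifold $Q$ presented by $\mathcal G$. \textbf{Lemma.} Let $\Gamma$ be a finitely generated group and let $\mathcal G,\mathcal H$ be orbifold groupoids. Then $\mathcal G^\Gamma$ and $\mathcal H^\Gamma$ are orbifold groupoids, and the following hold. \begin{enumerate} \item If $\Phi:\mathcal G\to\mathcal H$ is a homomorphism, then $\Phi_*:\mathcal G^\Gamma\to\mathcal H^\Gamma$, given by $\phi\mapsto\Phi_1\circ\phi$ on objects and by $(g,\phi)\mapsto(\Phi_1(g),\Phi_1\circ\phi)$ on arrows, is a homomorphism of Lie groupoids. \item If $\Phi$ is a strong equivalence, then $\Phi_*$ is a strong equivalence. \item Consequently $\tilde Q_\Gamma$ depends only on $Q$ and $\Gamma$: if $\mathcal G$ and $\mathcal H$ are Morita equivalent, then there are a homeomorphism $f:|\mathcal G^\Gamma|\to|\mathcal H^\Gamma|$, an orbifold groupoid $\mathcal L$ and equivalences $E:\mathcal L\to\mathcal G^\Gamma$ and $D:\mathcal L\to\mathcal H^\Gamma$ with $f\circ|E|=|D|$. \end{enumerate}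 -/

import Mathlib

open CategoryTheory
open scoped ContDiff Topology

universe u

namespace OrbifoldSectors

/-! ### Smooth manifolds whose components may have different dimensions -/

/-- The Euclidean space `ℝ^d`. -/
abbrev Euc (d : ℕ) : Type := EuclideanSpace ℝ (Fin d)

/-- A topological space together with a family of charts, each with values in some `ℝ^d`.
The dimension `d` may vary from chart to chart. -/
class Atlas (M : Type u) extends TopologicalSpace M where
  charts : ∀ d : ℕ, Set (OpenPartialHomeomorph M (Euc d))

/-- `e` has smooth transition maps, in both directions, with every chart of the atlas,
i.e. `e` is a smooth chart of `M` (a diffeomorphism onto an open subset of `ℝ^d`). -/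
def IsSmoothChart {M : Type u} [Atlas M] {d : ℕ} (e : OpenPartialHomeomorph M (Euc d)) : Prop :=
  ∀ (d' : ℕ), ∀ e' ∈ Atlas.charts (M := M) d',
    ContDiffOn ℝ ∞ (e' ∘ e.symm) (e.symm.trans e').source ∧
    ContDiffOn ℝ ∞ (e ∘ e'.symm) (e'.symm.trans e).source

/-- `M` with its atlas is a smooth manifold: Hausdorff, second countable, covered by
pairwise smoothly compatible charts. Components of different dimensions are allowed. -/
structure IsSmoothManifold (M : Type u) [Atlas M] : Prop where
  t2 : T2Space M
  secondCountable : SecondCountableTopology M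
  cover : ∀ x : M, ∃ d : ℕ, ∃ e ∈ Atlas.charts (M := M) d, x ∈ e.source
  compatible : ∀ (d : ℕ), ∀ e ∈ Atlas.charts (M := M) d, IsSmoothChart e

/-- `f` is smooth on the open set `U`. -/
def SmoothOn {M N : Type u} [Atlas M] [Atlas N] (f : M → N) (U : Set M) : Prop :=
  ContinuousOn f U ∧
  ∀ (d d' : ℕ), ∀ e ∈ Atlas.charts (M := M) d, ∀ e' ∈ Atlas.charts (M := N) d',
    ContDiffOn ℝ ∞ (e' ∘ f ∘ e.symm) (e.target ∩ e.symm ⁻¹' (U ∩ f ⁻¹' e'.source))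

/-- `f` is a smooth map. -/
def Smooth {M N : Type u} [Atlas M] [Atlas N] (f : M → N) : Prop := SmoothOn f Set.univ

/-- `f` is a submersion: smooth, with surjective differential (read in charts) at each point. -/
def IsSubmersion {M N : Type u} [Atlas M] [Atlas N] (f : M → N) : Prop :=
  Smooth f ∧
  ∀ (d d' : ℕ), ∀ e ∈ Atlas.charts (M := M) d, ∀ e' ∈ Atlas.charts (M := N) d',
    ∀ x ∈ e.source, f x ∈ e'.source →
      Function.Surjective (fderiv ℝ (e' ∘ f ∘ e.symm) (e x))

/-- `f` is a local diffeomorphism. -/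
def IsLocalDiffeo {M N : Type u} [Atlas M] [Atlas N] (f : M → N) : Prop :=
  ∀ x : M, ∃ e : OpenPartialHomeomorph M N, x ∈ e.source ∧ Set.EqOn f e e.source ∧
    SmoothOn e e.source ∧ SmoothOn e.symm e.target

/-- The atlas pulled back along a local homeomorphism `f : A → M`: its charts are the
maps `c ∘ f`, with `c` a chart of `M`, restricted to open sets of `A` on which they are
homeomorphisms onto open sets. It makes `f` a local diffeomorphism. -/
abbrev Atlas.pullback {A M : Type u} [TopologicalSpace A] [Atlas M] (f : A → M) : Atlas A where
  charts d := {e | ∃ c ∈ Atlas.charts (M := M) d, ∀ a ∈ e.source, f a ∈ c.source ∧ e a = c (f a)}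

/-! ### Lie groupoids and orbifold groupoids -/

/-- The set of all arrows of a groupoid. -/
structure Arr (C : Type u) [Groupoid.{u} C] : Type u where
  src : C
  tgt : C
  hom : src ⟶ tgt

/-- A groupoid whose set of objects and whose set of arrows carry a topology and charts. -/
structure ChartedGroupoid : Type (u + 1) where
  Ob : Type u
  [groupoid : Groupoid.{u} Ob]
  [obAtlas : Atlas Ob]
  [arAtlas : Atlas (Arr Ob)]

attribute [instance] ChartedGroupoid.groupoid ChartedGroupoid.obAtlas ChartedGroupoid.arAtlas

/-- Lie groupoids: objects and arrows form smooth manifolds, source and target are submersions,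
and all structure maps are smooth. Smoothness of the composition, which is defined on the
manifold of composable pairs of arrows, is tested on smooth maps from manifolds `P` into that
fibre product, i.e. on pairs of smooth families of arrows that are composable pointwise. -/
structure ChartedGroupoid.IsLie (G : ChartedGroupoid.{u}) : Prop where
  manifold_ob : IsSmoothManifold G.Ob
  manifold_ar : IsSmoothManifold (Arr G.Ob)
  submersion_src : IsSubmersion (fun a : Arr G.Ob => a.src)
  submersion_tgt : IsSubmersion (fun a : Arr G.Ob => a.tgt)
  smooth_id : Smooth (fun x : G.Ob => (⟨x, x, 𝟙 x⟩ : Arr G.Ob))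
  smooth_inv : Smooth (fun a : Arr G.Ob => (⟨a.tgt, a.src, Groupoid.inv a.hom⟩ : Arr G.Ob))
  smooth_comp : ∀ (P : Type u) [Atlas P], IsSmoothManifold P →
    ∀ (x y z : P → G.Ob) (f : ∀ p, x p ⟶ y p) (g : ∀ p, y p ⟶ z p),
      Smooth (fun p => (⟨x p, y p, f p⟩ : Arr G.Ob)) →
      Smooth (fun p => (⟨y p, z p, g p⟩ : Arr G.Ob)) →
      Smooth (fun p => (⟨x p, z p, f p ≫ g p⟩ : Arr G.Ob))

/-- Orbifold groupoids: proper étale Lie groupoids. -/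
structure ChartedGroupoid.IsOrbifold (G : ChartedGroupoid.{u}) : Prop extends G.IsLie where
  etale_src : IsLocalDiffeo (fun a : Arr G.Ob => a.src)
  etale_tgt : IsLocalDiffeo (fun a : Arr G.Ob => a.tgt)
  proper : IsProperMap (fun a : Arr G.Ob => (a.src, a.tgt))

/-! ### Homomorphisms, strong equivalences, Morita equivalence -/

/-- The map on arrows of a functor. -/
def Arr.map {C D : Type u} [Groupoid.{u} C] [Groupoid.{u} D] (F : C ⥤ D) (a : Arr C) : Arr D :=
  ⟨F.obj a.src, F.obj a.tgt, F.map a.hom⟩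

/-- Homomorphisms of Lie groupoids: functors that are smooth on objects and on arrows. -/
structure IsHom {G H : ChartedGroupoid.{u}} (F : G.Ob ⥤ H.Ob) : Prop where
  smooth_ob : Smooth F.obj
  smooth_ar : Smooth (Arr.map F)

/-- The commutative square with sides `F₁ : G₁ → H₁`, `(s, t) : G₁ → G₀ × G₀`,
`(s, t) : H₁ → H₀ × H₀` and `F₀ × F₀` is a fibred product in the category of manifolds. -/
def IsFibredProduct {G H : ChartedGroupoid.{u}} (F : G.Ob ⥤ H.Ob) : Prop :=
  ∀ (P : Type u) [Atlas P], IsSmoothManifold P →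
    ∀ (x y : P → G.Ob) (h : ∀ p, F.obj (x p) ⟶ F.obj (y p)),
      Smooth x → Smooth y → Smooth (fun p => (⟨_, _, h p⟩ : Arr H.Ob)) →
      ∃! g : ∀ p, x p ⟶ y p,
        Smooth (fun p => (⟨x p, y p, g p⟩ : Arr G.Ob)) ∧ ∀ p, F.map (g p) = h p

/-- Strong equivalences of Lie groupoids. -/
structure IsStrongEquivalence {G H : ChartedGroupoid.{u}} (F : G.Ob ⥤ H.Ob) : Prop
    extends IsHom F where
  surjective : Function.Surjective F.obj
  submersion : IsSubmersion F.obj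
  fibredProduct : IsFibredProduct F

/-- The space `H₁ ×_{H₀} G₀` of pairs of an arrow `h` of `H` and an object `x` of `G` with
`s(h) = F₀(x)`. -/
def ArrowsFrom {G H : ChartedGroupoid.{u}} (F : G.Ob ⥤ H.Ob) : Type u :=
  {p : Arr H.Ob × G.Ob // p.1.src = F.obj p.2}

/-- For `H` étale, the projection `H₁ ×_{H₀} G₀ → G₀` is étale, and the smooth structure of the
fibred product is the one that is pulled back along it. -/
instance {G H : ChartedGroupoid.{u}} (F : G.Ob ⥤ H.Ob) : Atlas (ArrowsFrom F) :=
  letI : TopologicalSpace (ArrowsFrom F) := TopologicalSpace.induced Subtype.val inferInstance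
  Atlas.pullback (fun p : ArrowsFrom F => p.1.2)

/-- Equivalences of étale Lie groupoids: `t ∘ pr₁ : H₁ ×_{H₀} G₀ → H₀` is a surjective
submersion, and `G₁` is the fibred product of `H₁` and `G₀ × G₀` over `H₀ × H₀`. -/
structure IsEquivalence {G H : ChartedGroupoid.{u}} (F : G.Ob ⥤ H.Ob) : Prop
    extends IsHom F where
  surjective : Function.Surjective (fun p : ArrowsFrom F => p.1.1.tgt)
  submersion : IsSubmersion (fun p : ArrowsFrom F => p.1.1.tgt)
  fibredProduct : IsFibredProduct F

/-- Two orbifold groupoids are Morita equivalent if there are equivalences to both of them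
from a third orbifold groupoid. -/
def MoritaEquivalent (G H : ChartedGroupoid.{u}) : Prop :=
  ∃ K : ChartedGroupoid.{u}, K.IsOrbifold ∧
    ∃ (E : K.Ob ⥤ G.Ob) (D : K.Ob ⥤ H.Ob), IsEquivalence E ∧ IsEquivalence D

/-- The orbit space `|G|`: the set of objects modulo the relation of being connected by an
arrow, with the quotient topology. -/
def ChartedGroupoid.OrbitSpace (G : ChartedGroupoid.{u}) : Type u :=
  Quotient (isIsomorphicSetoid G.Ob)

instance (G : ChartedGroupoid.{u}) : TopologicalSpace G.OrbitSpace :=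
  inferInstanceAs (TopologicalSpace (Quotient (isIsomorphicSetoid G.Ob)))

/-- The orbit of an object. -/
def ChartedGroupoid.orbit (G : ChartedGroupoid.{u}) (x : G.Ob) : G.OrbitSpace :=
  Quotient.mk (isIsomorphicSetoid G.Ob) x

/-- The homeomorphism `f : |G| → |H|` is an isomorphism between the orbifolds presented by
`G` and `H`, i.e. `(G, f)` and `(H, id)` are equivalent orbifold structures on `|H|`: there are
equivalences `E : K → G` and `D : K → H` from an orbifold groupoid `K` with `f ∘ |E| = |D|`. -/
def IsOrbifoldIso {G H : ChartedGroupoid.{u}} (f : G.OrbitSpace ≃ₜ H.OrbitSpace) : Prop :=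
  ∃ K : ChartedGroupoid.{u}, K.IsOrbifold ∧
    ∃ (E : K.Ob ⥤ G.Ob) (D : K.Ob ⥤ H.Ob), IsEquivalence E ∧ IsEquivalence D ∧
      ∀ k : K.Ob, f (G.orbit (E.obj k)) = H.orbit (D.obj k)

/-! ### Linear charts -/

/-- A linear orbifold chart at the object `x`: a neighbourhood `V` of `x` (the source of `chart`)
with a diffeomorphism `V → ℝ^n` that takes `x` to the origin, an identification of the
restriction `G|_V` with an action groupoid `G_x ⋉ V` through a homomorphism `ξ : G|_V → G_x`,
and a linear representation of `G_x` on `ℝ^n` that corresponds to the action on `V`.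
(The values of `ξ` on arrows that leave or enter `V` from outside play no role.)
`End x` is the isotropy group `G_x`, with `a * b` meaning: first `b`, then `a`. -/
structure LinearChart (G : ChartedGroupoid.{u}) (x : G.Ob) where
  dim : ℕ
  chart : OpenPartialHomeomorph G.Ob (Euc dim)
  smooth : IsSmoothChart chart
  mem_source : x ∈ chart.source
  target_eq : chart.target = Set.univ
  chart_base : chart x = 0
  rep : Representation ℝ (End x) (Euc dim)
  ξ : ∀ {y z : G.Ob}, (y ⟶ z) → End x
  ξ_comp : ∀ {y z w : G.Ob}, y ∈ chart.source → z ∈ chart.source → w ∈ chart.source →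
    ∀ (f : y ⟶ z) (g : z ⟶ w), ξ (f ≫ g) = ξ g * ξ f
  ξ_isotropy : ∀ k : End x, ξ (y := x) (z := x) k = k
  ξ_bijective : ∀ y ∈ chart.source, ∀ k : End x,
    ∃! a : (z : G.Ob) × (y ⟶ z), a.1 ∈ chart.source ∧ ξ a.2 = k
  ξ_locallyConstant : ∀ k : End x,
    IsOpen {a : Arr G.Ob | a.src ∈ chart.source ∧ a.tgt ∈ chart.source ∧ ξ a.hom = k}
  equivariant : ∀ {y z : G.Ob}, y ∈ chart.source → z ∈ chart.source →
    ∀ f : y ⟶ z, chart z = rep (ξ f) (chart y)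

namespace LinearChart

variable {G : ChartedGroupoid.{u}} {x : G.Ob} (c : LinearChart G x)
variable {Γ : Type u} [Group Γ] (φ : Γ →* End x)

/-- The fixed-point subspace of the image of `φ` in the representation space. -/
def fixedSubspace : Submodule ℝ (Euc c.dim) where
  carrier := {v | ∀ γ, c.rep (φ γ) v = v}
  add_mem' := fun ha hb γ => by rw [map_add, ha γ, hb γ]
  zero_mem' := fun γ => map_zero _
  smul_mem' := fun r v hv γ => by rw [map_smul, hv γ]

/-- The fixed-point subset `V^⟨φ⟩` of the image of `φ` in `V`. -/
def fixedSet : Set G.Ob := {y | y ∈ c.chart.source ∧ c.chart y ∈ c.fixedSubspace φ}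

/-- The homomorphism `ξ^y : G_y → G_x`, for `y` in `V`. -/
def ξAt {y : G.Ob} (hy : y ∈ c.chart.source) : End y →* End x :=
  MonoidHom.mk' (fun k => c.ξ (y := y) (z := y) k) (fun a b => c.ξ_comp hy hy hy b a)

theorem ξAt_injective {y : G.Ob} (hy : y ∈ c.chart.source) :
    Function.Injective (c.ξAt hy) := by
  intro a b hab
  obtain ⟨w, -, hw⟩ := c.ξ_bijective y hy (c.ξAt hy b)
  have h1 := hw ⟨y, a⟩ ⟨hy, hab⟩
  have h2 := hw ⟨y, b⟩ ⟨hy, rfl⟩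
  have h3 := h1.trans h2.symm
  exact eq_of_heq (Sigma.mk.inj h3).2

theorem mem_range_ξAt {y : G.Ob} (hy : y ∈ c.fixedSet φ) (γ : Γ) :
    φ γ ∈ (c.ξAt hy.1).range := by
  obtain ⟨⟨z, a⟩, ⟨hz, ha⟩, -⟩ := c.ξ_bijective y hy.1 (φ γ)
  have hzy : z = y := by
    apply c.chart.injOn hz hy.1
    rw [c.equivariant hy.1 hz a]
    simp only at ha
    rw [ha]
    exact hy.2 γ
  subst hzy
  exact ⟨a, ha⟩

/-- The homomorphism `φ_y = (ξ^y)⁻¹ ∘ φ : Γ → G_y`, for `y` in `V^⟨φ⟩`. -/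
noncomputable def lift {y : G.Ob} (hy : y ∈ c.fixedSet φ) : Γ →* End y :=
  (MonoidHom.ofInjective (c.ξAt_injective hy.1)).symm.toMonoidHom.comp
    (φ.codRestrict (c.ξAt hy.1).range (c.mem_range_ξAt φ hy))

/-- `φ_y` is characterised by `ξ^y ∘ φ_y = φ`. -/
theorem ξ_lift {y : G.Ob} (hy : y ∈ c.fixedSet φ) (γ : Γ) : c.ξ (c.lift φ hy γ) = φ γ := by
  have h := (MonoidHom.ofInjective (c.ξAt_injective hy.1)).apply_symm_apply
    (φ.codRestrict (c.ξAt hy.1).range (c.mem_range_ξAt φ hy) γ)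
  exact congrArg Subtype.val h

theorem symm_mem_fixedSet (v : c.fixedSubspace φ) : c.chart.symm v ∈ c.fixedSet φ := by
  have hv : (v : Euc c.dim) ∈ c.chart.target := by rw [c.target_eq]; trivial
  refine ⟨c.chart.map_target hv, ?_⟩
  rw [c.chart.right_inv hv]
  exact v.2

end LinearChart

/-! ### The groupoid of `Γ`-sectors -/

/-- The set `S_G^Γ` of pairs of an object `x` and a homomorphism `φ : Γ → G_x`. The projection
to the object `x` is the anchor map. -/
structure Sector (Γ : Type u) [Group Γ] (G : ChartedGroupoid.{u}) : Type u where
  pt : G.Ob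
  φ : Γ →* End pt

section

variable {Γ : Type u} [Group Γ] {G : ChartedGroupoid.{u}}

/-- The map `κ_φ : V^⟨φ⟩ → S_G^Γ`, `y ↦ φ_y`. -/
noncomputable def LinearChart.kappa {x : G.Ob} (c : LinearChart G x) (φ : Γ →* End x)
    (y : c.fixedSet φ) : Sector Γ G := ⟨y.1, c.lift φ y.2⟩

/-- The topology of `S_G^Γ` is the one induced by the maps `κ_φ`: a set is open if and only if
all its preimages under these maps are open. -/
noncomputable abbrev Sector.topology (Γ : Type u) [Group Γ] (G : ChartedGroupoid.{u}) :
    TopologicalSpace (Sector Γ G) :=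
  ⨆ (x : G.Ob) (c : LinearChart G x) (φ : Γ →* End x),
    TopologicalSpace.coinduced (c.kappa φ) (instTopologicalSpaceSubtype (X := G.Ob))

/-- The charts of `S_G^Γ` are the inverses of the `κ_φ`, where the fixed-point set `V^⟨φ⟩` is
identified, by the linear chart, with the linear subspace of fixed vectors, and this one with
some `ℝ^d` by a linear isomorphism `L`. -/
noncomputable instance : Atlas (Sector Γ G) :=
  letI : TopologicalSpace (Sector Γ G) := Sector.topology Γ G
  { charts := fun d => {e | ∃ (x : G.Ob) (c : LinearChart G x) (φ : Γ →* End x)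
      (L : Euc d ≃ₗ[ℝ] c.fixedSubspace φ), e.target = Set.univ ∧
        ∀ v : Euc d, e.symm v = c.kappa φ ⟨c.chart.symm (L v), c.symm_mem_fixedSet φ (L v)⟩} }

/-- The action of an arrow `g : x ⟶ y` on `Hom(Γ, G_x)` by conjugation, `γ ↦ g φ(γ) g⁻¹`
(the notation `≫` of Mathlib composes in diagrammatic order). -/
def conj {x y : G.Ob} (g : x ⟶ y) (φ : Γ →* End x) : Γ →* End y where
  toFun γ := Groupoid.inv g ≫ φ γ ≫ g
  map_one' := by
    rw [map_one, End.one_def]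
    simp
  map_mul' a b := by
    rw [map_mul, End.mul_def, End.mul_def]
    simp

theorem conj_id {x : G.Ob} (φ : Γ →* End x) : conj (𝟙 x) φ = φ := by
  ext γ
  simp [conj]

theorem conj_comp {x y z : G.Ob} (f : x ⟶ y) (g : y ⟶ z) (φ : Γ →* End x) :
    conj (f ≫ g) φ = conj g (conj f φ) := by
  ext γ
  simp [conj]

theorem conj_map {H : ChartedGroupoid.{u}} (F : G.Ob ⥤ H.Ob) {x y : G.Ob} (g : x ⟶ y)
    (φ : Γ →* End x) :
    conj (F.map g) ((F.mapEnd x).comp φ) = (F.mapEnd y).comp (conj g φ) := by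
  ext γ
  simp [conj, Functor.mapEnd]

/-- The action groupoid `G ⋉ S_G^Γ`: an arrow from `φ` to `ψ` is an arrow `g` of `G` with
`g φ = ψ`. -/
instance : Groupoid.{u} (Sector Γ G) where
  Hom φ ψ := {g : φ.pt ⟶ ψ.pt // conj g φ.φ = ψ.φ}
  id φ := ⟨𝟙 _, conj_id φ.φ⟩
  comp f g := ⟨f.1 ≫ g.1, (conj_comp f.1 g.1 _).trans ((congrArg (conj g.1) f.2).trans g.2)⟩
  id_comp f := Subtype.ext (Category.id_comp _)
  comp_id f := Subtype.ext (Category.comp_id _)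
  assoc f g h := Subtype.ext (Category.assoc _ _ _)
  inv f := ⟨Groupoid.inv f.1, (congrArg (conj (Groupoid.inv f.1)) f.2.symm).trans
    ((conj_comp f.1 (Groupoid.inv f.1) _).symm.trans (by rw [Groupoid.comp_inv, conj_id]))⟩
  inv_comp f := Subtype.ext (Groupoid.inv_comp _)
  comp_inv f := Subtype.ext (Groupoid.comp_inv _)

/-- The arrow `(g, φ)` of `G ⋉ S_G^Γ`, as an element of `G₁ × S_G^Γ`. -/
def Sector.arrowPair (a : Arr (Sector Γ G)) : Arr G.Ob × Sector Γ G :=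
  (⟨a.src.pt, a.tgt.pt, a.hom.1⟩, a.src)

/-- The arrows of the action groupoid form the fibred product `G₁ ×_{G₀} S_G^Γ`, with the
subspace topology from `G₁ × S_G^Γ`. As `G` is étale, the projection of the fibred product to
`S_G^Γ` (the source map) is étale, and the smooth structure is pulled back along it. -/
noncomputable instance : Atlas (Arr (Sector Γ G)) :=
  letI : TopologicalSpace (Arr (Sector Γ G)) :=
    TopologicalSpace.induced Sector.arrowPair inferInstance
  Atlas.pullback (fun a : Arr (Sector Γ G) => a.src)

end

/-- The groupoid `G^Γ = G ⋉ S_G^Γ` of `Γ`-sectors. Its orbit space is the space of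
`Γ`-sectors. -/
noncomputable def sectors (Γ : Type u) [Group Γ] (G : ChartedGroupoid.{u}) :
    ChartedGroupoid.{u} where
  Ob := Sector Γ G

/-- The functor `F_* : G^Γ → H^Γ` induced by `F : G → H`: on objects `φ ↦ F₁ ∘ φ`, and on
arrows `(g, φ) ↦ (F₁(g), F_*(φ))`. -/
def sectorsMap (Γ : Type u) [Group Γ] {G H : ChartedGroupoid.{u}} (F : G.Ob ⥤ H.Ob) :
    (sectors Γ G).Ob ⥤ (sectors Γ H).Ob where
  obj φ := (⟨F.obj φ.pt, (F.mapEnd φ.pt).comp φ.φ⟩ : Sector Γ H)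
  map g := ⟨F.map g.1, (conj_map F g.1 _).trans (congrArg (F.mapEnd _).comp g.2)⟩
  map_id _ := Subtype.ext (F.map_id _)
  map_comp _ _ := Subtype.ext (F.map_comp _ _)

end OrbifoldSectors

/-! A sector over `y` is a homomorphism from `Γ` into a finite isotropy group, so it carries no
continuous information beyond the point `y`. In a linear chart the label `ξ` is locally constant on
arrows. Hence a sector `ψ` whose values on finitely many generators are close to those of `φ`
satisfies `ξ ∘ ψ = φ`, which says that `ψ` lies in the image of `κ_φ`. The topology determined by
the `κ_φ` is therefore that of pointwise convergence (`Sector.isEmbedding_ev`), and the images of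
the `κ_φ` are open. In the resulting charts the anchor map is the inclusion of a fixed subspace.
This gives the criterion used throughout: a map into the sectors is smooth if and only if all its
evaluations are continuous and its base point varies smoothly (`Sector.smooth_iff`).

Enough linear charts exist by `nonempty_linearChart`: properness makes the isotropy finite and `G`
an action groupoid near `x`, averaging a chart linearises the action, and a radial diffeomorphism
stretches an invariant ball onto the whole space.

The source map of `G^Γ` is a base change of the étale source map of `G`, the target is the source
after inversion, and the arrows form a closed subset of `G₁ × S_G^Γ`, which gives properness.

A homomorphism reads in linear charts as a map whose derivative at a fixed point intertwines the two
actions of `Γ`. If that derivative is onto, averaging over the finite image of `Γ` shows that it is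
onto on fixed vectors, so submersions induce submersions on sectors. The fibred product property
makes the functor fully faithful, so homomorphisms into isotropy groups lift.

For Morita invariance the same is proved for all equivalences, using that between étale groupoids
the submersion condition amounts to `F.obj` being a submersion. Equivalences induce homeomorphisms
of orbit spaces. -/

namespace OrbifoldSectors

/-! ### Germs of smooth maps and submersions -/

section Germs

variable {M N P : Type u} [Atlas M] [Atlas N] [Atlas P]

/-- `f` is smooth near `x`, read in the charts of the two atlases. -/
def SmoothAt (f : M → N) (x : M) : Prop :=
  ContinuousAt f x ∧ ∀ (d d' : ℕ), ∀ e ∈ Atlas.charts (M := M) d, ∀ e' ∈ Atlas.charts (M := N) d',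
    x ∈ e.source → f x ∈ e'.source → ContDiffAt ℝ ∞ (e' ∘ f ∘ e.symm) (e x)

/-- `f` is smooth near `x` with surjective differential at `x`. -/
def SubmersionAt (f : M → N) (x : M) : Prop :=
  SmoothAt f x ∧
  ∀ (d d' : ℕ), ∀ e ∈ Atlas.charts (M := M) d, ∀ e' ∈ Atlas.charts (M := N) d',
    x ∈ e.source → f x ∈ e'.source → Function.Surjective (fderiv ℝ (e' ∘ f ∘ e.symm) (e x))

theorem smoothOn_iff {f : M → N} {U : Set M} (hU : IsOpen U) :
    SmoothOn f U ↔ ∀ x ∈ U, SmoothAt f x := by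
  constructor
  · rintro ⟨hc, hs⟩ x hx
    have hcx : ContinuousAt f x := hc.continuousAt (hU.mem_nhds hx)
    refine ⟨hcx, fun d d' e he e' he' hxe hxe' => (hs d d' e he e' he').contDiffAt ?_⟩
    refine Filter.inter_mem (e.open_target.mem_nhds (e.map_source hxe)) ?_
    refine (e.continuousAt_symm (e.map_source hxe)).preimage_mem_nhds ?_
    rw [e.left_inv hxe]
    exact Filter.inter_mem (hU.mem_nhds hx)
      (hcx.preimage_mem_nhds (e'.open_source.mem_nhds hxe'))
  · intro h
    refine ⟨fun x hx => (h x hx).1.continuousWithinAt, fun d d' e he e' he' v hv => ?_⟩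
    obtain ⟨hvt, hvU, hvs⟩ := hv
    have := (h _ hvU).2 d d' e he e' he' (e.map_target hvt) hvs
    rw [e.right_inv hvt] at this
    exact this.contDiffWithinAt

theorem smooth_iff {f : M → N} : Smooth f ↔ ∀ x, SmoothAt f x := by
  simp [Smooth, smoothOn_iff isOpen_univ]

theorem Smooth.smoothAt {f : M → N} (h : Smooth f) (x : M) : SmoothAt f x := smooth_iff.1 h x

theorem Smooth.continuous {f : M → N} (h : Smooth f) : Continuous f :=
  continuousOn_univ.1 h.1

theorem isSubmersion_iff {f : M → N} : IsSubmersion f ↔ ∀ x, SubmersionAt f x := by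
  constructor
  · rintro ⟨hs, h⟩ x
    exact ⟨hs.smoothAt x, fun d d' e he e' he' => h d d' e he e' he' x⟩
  · intro h
    exact ⟨smooth_iff.2 fun x => (h x).1, fun d d' e he e' he' x => (h x).2 d d' e he e' he'⟩

theorem IsSmoothManifold.exists_chart (hM : IsSmoothManifold M) (x : M) :
    ∃ (d : ℕ) (e : OpenPartialHomeomorph M (Euc d)), e ∈ Atlas.charts (M := M) d ∧
      IsSmoothChart e ∧ x ∈ e.source := by
  obtain ⟨d, e, he, hx⟩ := hM.cover x
  exact ⟨d, e, he, hM.compatible d e he, hx⟩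

/-- Neither chart need belong to the atlas, so the transition is factored through an atlas chart
around `x`. -/
theorem IsSmoothChart.contDiffAt_transition (hM : IsSmoothManifold M) {d d' : ℕ}
    {e : OpenPartialHomeomorph M (Euc d)} {e' : OpenPartialHomeomorph M (Euc d')}
    (he : IsSmoothChart e) (he' : IsSmoothChart e') {x : M} (hx : x ∈ e.source)
    (hx' : x ∈ e'.source) : ContDiffAt ℝ ∞ (e' ∘ e.symm) (e x) := by
  obtain ⟨k, c, hc, hxc⟩ := hM.cover x
  have h1 : ContDiffAt ℝ ∞ (c ∘ e.symm) (e x) := by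
    refine ((he k c hc).1).contDiffAt ((e.symm.trans c).open_source.mem_nhds ?_)
    simp [hx, hxc]
  have h2 : ContDiffAt ℝ ∞ (e' ∘ c.symm) (c x) := by
    refine ((he' k c hc).2).contDiffAt ((c.symm.trans e').open_source.mem_nhds ?_)
    simp [hx', hxc]
  have h3 : ContDiffAt ℝ ∞ ((e' ∘ c.symm) ∘ (c ∘ e.symm)) (e x) := by
    refine ContDiffAt.comp _ ?_ h1
    simpa [hx] using h2
  refine h3.congr_of_eventuallyEq ?_
  have : ∀ᶠ w in 𝓝 (e x), e.symm w ∈ c.source := by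
    refine (e.continuousAt_symm (e.map_source hx)).preimage_mem_nhds ?_
    rw [e.left_inv hx]
    exact c.open_source.mem_nhds hxc
  filter_upwards [this] with w hw
  simp [hw]

/-- The derivative of the reverse transition is a right inverse, by the chain rule; no comparison of
`d` with `d'` is needed. -/
theorem IsSmoothChart.surjective_fderiv_transition (hM : IsSmoothManifold M) {d d' : ℕ}
    {e : OpenPartialHomeomorph M (Euc d)} {e' : OpenPartialHomeomorph M (Euc d')}
    (he : IsSmoothChart e) (he' : IsSmoothChart e') {x : M} (hx : x ∈ e.source)
    (hx' : x ∈ e'.source) : Function.Surjective (fderiv ℝ (e' ∘ e.symm) (e x)) := by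
  have h1 := (he.contDiffAt_transition hM he' hx hx').differentiableAt (by simp)
  have h2 := (he'.contDiffAt_transition hM he hx' hx).differentiableAt (by simp)
  have hpt : (e ∘ e'.symm) (e' x) = e x := by simp [hx']
  rw [← hpt] at h1 ⊢
  have h3 := fderiv_comp _ h1 h2
  have h4 : (e' ∘ e.symm) ∘ (e ∘ e'.symm) =ᶠ[𝓝 (e' x)] id := by
    have : ∀ᶠ w in 𝓝 (e' x), w ∈ e'.target ∧ e'.symm w ∈ e.source := by
      refine Filter.inter_mem (e'.open_target.mem_nhds (e'.map_source hx'))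
        ((e'.continuousAt_symm (e'.map_source hx')).preimage_mem_nhds ?_)
      rw [e'.left_inv hx']
      exact e.open_source.mem_nhds hx
    filter_upwards [this] with w hw
    simp [hw.1, hw.2]
  rw [h4.fderiv_eq, fderiv_id] at h3
  intro v
  exact ⟨_, (congrArg (fun T => T v) h3).symm⟩

section Change

variable (hM : IsSmoothManifold M) (hN : IsSmoothManifold N) {f : M → N} {x : M}
  (hf : ContinuousAt f x) {d₁ d₂ d₁' d₂' : ℕ}
  {e₁ : OpenPartialHomeomorph M (Euc d₁)} {e₂ : OpenPartialHomeomorph M (Euc d₂)}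
  {e₁' : OpenPartialHomeomorph N (Euc d₁')} {e₂' : OpenPartialHomeomorph N (Euc d₂')}
  (h₁ : IsSmoothChart e₁) (h₂ : IsSmoothChart e₂)
  (h₁' : IsSmoothChart e₁') (h₂' : IsSmoothChart e₂')
  (hx₁ : x ∈ e₁.source) (hx₂ : x ∈ e₂.source) (hx₁' : f x ∈ e₁'.source) (hx₂' : f x ∈ e₂'.source)

include hf hx₁ hx₂ hx₁' in
theorem chart_change_eventuallyEq :
    e₂' ∘ f ∘ e₂.symm =ᶠ[𝓝 (e₂ x)]
      (e₂' ∘ e₁'.symm) ∘ (e₁' ∘ f ∘ e₁.symm) ∘ (e₁ ∘ e₂.symm) := by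
  have hc := e₂.continuousAt_symm (e₂.map_source hx₂)
  have hc' := hc
  rw [ContinuousAt, e₂.left_inv hx₂] at hc
  have h1 := hc.eventually (e₁.open_source.mem_nhds hx₁)
  have h2 := hc.eventually (hf.preimage_mem_nhds (e₁'.open_source.mem_nhds hx₁'))
  filter_upwards [h1, h2] with w hw1 hw2
  have hw2' : f (e₂.symm w) ∈ e₁'.source := hw2
  have hw1' : e₂.symm w ∈ e₁.source := hw1
  simp [hw1', hw2']

include hM hN hf h₁ h₂ h₁' h₂' hx₁ hx₂ hx₁' hx₂' in
theorem contDiffAt_chart_change (h : ContDiffAt ℝ ∞ (e₁' ∘ f ∘ e₁.symm) (e₁ x)) :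
    ContDiffAt ℝ ∞ (e₂' ∘ f ∘ e₂.symm) (e₂ x) := by
  refine ContDiffAt.congr_of_eventuallyEq ?_
    (chart_change_eventuallyEq (e₂' := e₂') hf hx₁ hx₂ hx₁')
  have hp : (e₁ ∘ e₂.symm) (e₂ x) = e₁ x := by simp [hx₂]
  refine ContDiffAt.comp _ ?_ (ContDiffAt.comp _ ?_ (h₂.contDiffAt_transition hM h₁ hx₂ hx₁))
  · simpa [hx₁, hx₂] using h₁'.contDiffAt_transition hN h₂' hx₁' hx₂'
  · rwa [hp]

include hM hN hf h₁ h₂ h₁' h₂' hx₁ hx₂ hx₁' hx₂' in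
theorem surjective_fderiv_chart_change (h : ContDiffAt ℝ ∞ (e₁' ∘ f ∘ e₁.symm) (e₁ x))
    (hs : Function.Surjective (fderiv ℝ (e₁' ∘ f ∘ e₁.symm) (e₁ x))) :
    Function.Surjective (fderiv ℝ (e₂' ∘ f ∘ e₂.symm) (e₂ x)) := by
  rw [(chart_change_eventuallyEq (e₂' := e₂') hf hx₁ hx₂ hx₁').fderiv_eq]
  have hp : (e₁ ∘ e₂.symm) (e₂ x) = e₁ x := by simp [hx₂]
  have hq : (e₁' ∘ f ∘ e₁.symm) (e₁ x) = e₁' (f x) := by simp [hx₁]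
  have d1 := (h₂.contDiffAt_transition hM h₁ hx₂ hx₁).differentiableAt (by simp)
  have s1 := h₂.surjective_fderiv_transition hM h₁ hx₂ hx₁
  have d3 := (h₁'.contDiffAt_transition hN h₂' hx₁' hx₂').differentiableAt (by simp)
  have s3 := h₁'.surjective_fderiv_transition hN h₂' hx₁' hx₂'
  have d2 := h.differentiableAt (by simp)
  rw [← hp] at d2 hs hq
  rw [← hq] at d3 s3
  have d12 : DifferentiableAt ℝ ((e₁' ∘ f ∘ e₁.symm) ∘ (e₁ ∘ e₂.symm)) (e₂ x) := d2.comp _ d1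
  rw [fderiv_comp (g := e₂' ∘ e₁'.symm) (f := (e₁' ∘ f ∘ e₁.symm) ∘ (e₁ ∘ e₂.symm)) _ d3 d12,
    fderiv_comp (g := e₁' ∘ f ∘ e₁.symm) _ d2 d1]
  exact s3.comp (hs.comp s1)

-- A single pair of smooth charts suffices, and they may lie outside the atlases. This is what
-- allows linear charts to be used for computations.
include hM hN h₁ h₁' hx₁ hx₁' in
theorem smoothAt_iff : SmoothAt f x ↔
    ContinuousAt f x ∧ ContDiffAt ℝ ∞ (e₁' ∘ f ∘ e₁.symm) (e₁ x) := by
  constructor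
  · intro h
    obtain ⟨d, e, he, hes, hxe⟩ := hM.exists_chart x
    obtain ⟨d', e', he', hes', hxe'⟩ := hN.exists_chart (f x)
    exact ⟨h.1, contDiffAt_chart_change hM hN h.1 hes h₁ hes' h₁' hxe hx₁ hxe' hx₁'
      (h.2 _ _ e he e' he' hxe hxe')⟩
  · rintro ⟨hc, h⟩
    exact ⟨hc, fun d d' e he e' he' hx hx' => contDiffAt_chart_change hM hN hc h₁
      (hM.compatible _ e he) h₁' (hN.compatible _ e' he') hx₁ hx hx₁' hx' h⟩

include hM hN h₁ h₁' hx₁ hx₁' in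
theorem submersionAt_iff : SubmersionAt f x ↔
    SmoothAt f x ∧ Function.Surjective (fderiv ℝ (e₁' ∘ f ∘ e₁.symm) (e₁ x)) := by
  constructor
  · intro h
    obtain ⟨d, e, he, hes, hxe⟩ := hM.exists_chart x
    obtain ⟨d', e', he', hes', hxe'⟩ := hN.exists_chart (f x)
    exact ⟨h.1, surjective_fderiv_chart_change hM hN h.1.1 hes h₁ hes' h₁' hxe hx₁ hxe' hx₁'
      (h.1.2 _ _ e he e' he' hxe hxe') (h.2 _ _ e he e' he' hxe hxe')⟩
  · rintro ⟨hc, h⟩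
    exact ⟨hc, fun d d' e he e' he' hx hx' => surjective_fderiv_chart_change hM hN hc.1 h₁
      (hM.compatible _ e he) h₁' (hN.compatible _ e' he') hx₁ hx hx₁' hx'
      ((smoothAt_iff hM hN h₁ h₁' hx₁ hx₁').1 hc).2 h⟩

end Change

theorem SmoothAt.congr {f g : M → N} {x : M} (h : SmoothAt f x) (hfg : g =ᶠ[𝓝 x] f) :
    SmoothAt g x := by
  refine ⟨h.1.congr hfg.symm, fun d d' e he e' he' hx hx' => ?_⟩
  refine (h.2 d d' e he e' he' hx (hfg.eq_of_nhds ▸ hx')).congr_of_eventuallyEq ?_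
  have hc := e.continuousAt_symm (e.map_source hx)
  rw [ContinuousAt, e.left_inv hx] at hc
  filter_upwards [hc.eventually hfg] with w hw
  simp [hw]

theorem SubmersionAt.congr {f g : M → N} {x : M} (h : SubmersionAt f x) (hfg : g =ᶠ[𝓝 x] f) :
    SubmersionAt g x := by
  refine ⟨h.1.congr hfg, fun d d' e he e' he' hx hx' => ?_⟩
  have hc := e.continuousAt_symm (e.map_source hx)
  rw [ContinuousAt, e.left_inv hx] at hc
  have : e' ∘ g ∘ e.symm =ᶠ[𝓝 (e x)] e' ∘ f ∘ e.symm := by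
    filter_upwards [hc.eventually hfg] with w hw
    simp [hw]
  rw [this.fderiv_eq]
  exact h.2 d d' e he e' he' hx (hfg.eq_of_nhds ▸ hx')

theorem SmoothAt.comp_eventuallyEq {g : N → P} {f : M → N} {x : M} (hf : ContinuousAt f x)
    {d d' d'' : ℕ} {e : OpenPartialHomeomorph M (Euc d)} {e' : OpenPartialHomeomorph N (Euc d')}
    {e'' : OpenPartialHomeomorph P (Euc d'')} (hx : x ∈ e.source) (hx' : f x ∈ e'.source) :
    e'' ∘ (g ∘ f) ∘ e.symm =ᶠ[𝓝 (e x)] (e'' ∘ g ∘ e'.symm) ∘ (e' ∘ f ∘ e.symm) := by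
  have hc := e.continuousAt_symm (e.map_source hx)
  rw [ContinuousAt, e.left_inv hx] at hc
  filter_upwards [hc.eventually (hf.preimage_mem_nhds (e'.open_source.mem_nhds hx'))] with w hw
  have hw' : f (e.symm w) ∈ e'.source := hw
  simp [hw']

theorem SmoothAt.comp (hN : IsSmoothManifold N) {g : N → P} {f : M → N} {x : M}
    (hg : SmoothAt g (f x)) (hf : SmoothAt f x) : SmoothAt (g ∘ f) x := by
  refine ⟨hg.1.comp hf.1, fun d d'' e he e'' he'' hx hx'' => ?_⟩
  obtain ⟨d', e', he', -, hx'⟩ := hN.exists_chart (f x)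
  refine ContDiffAt.congr_of_eventuallyEq ?_ (SmoothAt.comp_eventuallyEq hf.1 hx hx')
  refine ContDiffAt.comp _ ?_ (hf.2 _ _ e he e' he' hx hx')
  simpa [hx] using hg.2 _ _ e' he' e'' he'' hx' hx''

theorem fderiv_chart_comp {g : N → P} {f : M → N} {x : M}
    (hg : SmoothAt g (f x)) (hf : SmoothAt f x) {d d' d'' : ℕ}
    {e : OpenPartialHomeomorph M (Euc d)} {e' : OpenPartialHomeomorph N (Euc d')}
    {e'' : OpenPartialHomeomorph P (Euc d'')} (he : e ∈ Atlas.charts (M := M) d)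
    (he' : e' ∈ Atlas.charts (M := N) d') (he'' : e'' ∈ Atlas.charts (M := P) d'')
    (hx : x ∈ e.source) (hx' : f x ∈ e'.source) (hx'' : g (f x) ∈ e''.source) :
    fderiv ℝ (e'' ∘ (g ∘ f) ∘ e.symm) (e x) =
      (fderiv ℝ (e'' ∘ g ∘ e'.symm) (e' (f x))).comp (fderiv ℝ (e' ∘ f ∘ e.symm) (e x)) := by
  rw [(SmoothAt.comp_eventuallyEq hf.1 hx hx').fderiv_eq]
  have hp : (e' ∘ f ∘ e.symm) (e x) = e' (f x) := by simp [hx]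
  have h1 := (hg.2 _ _ e' he' e'' he'' hx' hx'').differentiableAt (by simp)
  rw [← hp] at h1 ⊢
  exact fderiv_comp _ h1 ((hf.2 _ _ e he e' he' hx hx').differentiableAt (by simp))

theorem SubmersionAt.comp (hN : IsSmoothManifold N) {g : N → P} {f : M → N} {x : M}
    (hg : SubmersionAt g (f x)) (hf : SubmersionAt f x) : SubmersionAt (g ∘ f) x := by
  refine ⟨hg.1.comp hN hf.1, fun d d'' e he e'' he'' hx hx'' => ?_⟩
  obtain ⟨d', e', he', -, hx'⟩ := hN.exists_chart (f x)
  rw [fderiv_chart_comp hg.1 hf.1 he he' he'' hx hx' hx'']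
  exact (hg.2 _ _ e' he' e'' he'' hx' hx'').comp (hf.2 _ _ e he e' he' hx hx')

/-- By the chain rule, a composite of linear maps can be onto only if the outer factor is. -/
theorem SubmersionAt.of_comp (hM : IsSmoothManifold M) {g : N → P} {f : M → N}
    {x : M} (hgf : SubmersionAt (g ∘ f) x) (hg : SmoothAt g (f x)) (hf : SmoothAt f x) :
    SubmersionAt g (f x) := by
  refine ⟨hg, fun d' d'' e' he' e'' he'' hx' hx'' => ?_⟩
  obtain ⟨d, e, he, -, hx⟩ := hM.exists_chart x
  have := hgf.2 _ _ e he e'' he'' hx hx''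
  rw [fderiv_chart_comp hg hf he he' he'' hx hx' hx''] at this
  exact Function.Surjective.of_comp this

theorem Smooth.comp (hN : IsSmoothManifold N) {g : N → P} {f : M → N}
    (hg : Smooth g) (hf : Smooth f) : Smooth (g ∘ f) :=
  smooth_iff.2 fun x => (hg.smoothAt _).comp hN (hf.smoothAt x)

theorem smoothAt_id (hM : IsSmoothManifold M) (x : M) : SmoothAt (id : M → M) x := by
  obtain ⟨d, e, he, hes, hx⟩ := hM.exists_chart x
  exact (smoothAt_iff hM hM hes hes hx hx).2
    ⟨continuousAt_id, hes.contDiffAt_transition hM hes hx hx⟩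

theorem submersionAt_id (hM : IsSmoothManifold M) (x : M) : SubmersionAt (id : M → M) x := by
  obtain ⟨d, e, he, hes, hx⟩ := hM.exists_chart x
  exact (submersionAt_iff hM hM hes hes hx hx).2
    ⟨smoothAt_id hM x, hes.surjective_fderiv_transition hM hes hx hx⟩

/-! ### Local diffeomorphisms -/

theorem IsLocalDiffeo.smooth {f : M → N} (hf : IsLocalDiffeo f) :
    Smooth f := by
  refine smooth_iff.2 fun x => ?_
  obtain ⟨e, hx, hfe, hes, -⟩ := hf x
  exact ((smoothOn_iff e.open_source).1 hes x hx).congr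
    (hfe.eventuallyEq_of_mem (e.open_source.mem_nhds hx))

theorem IsLocalDiffeo.isLocalHomeomorph {f : M → N} (hf : IsLocalDiffeo f) :
    IsLocalHomeomorph f :=
  IsLocalHomeomorph.mk f fun x => by
    obtain ⟨e, hx, hfe, -, -⟩ := hf x
    exact ⟨e, hx, hfe⟩

/-- A local diffeomorphism has a local inverse through each point. -/
theorem IsLocalDiffeo.exists_section {f : M → N} (hf : IsLocalDiffeo f) (x : M) :
    ∃ σ : N → M, SmoothAt σ (f x) ∧ σ (f x) = x ∧ (∀ᶠ y in 𝓝 (f x), f (σ y) = y) ∧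
      ∀ᶠ x' in 𝓝 x, σ (f x') = x' := by
  obtain ⟨e, hx, hfe, -, hes⟩ := hf x
  have hfx : f x ∈ e.target := by rw [hfe hx]; exact e.map_source hx
  refine ⟨e.symm, (smoothOn_iff e.open_target).1 hes _ hfx, by rw [hfe hx, e.left_inv hx], ?_, ?_⟩
  · filter_upwards [e.open_target.mem_nhds hfx] with y hy
    rw [hfe (e.map_target hy), e.right_inv hy]
  · filter_upwards [e.open_source.mem_nhds hx] with y hy
    rw [hfe hy, e.left_inv hy]

/-- Near `x` one has `f = σ ∘ (g ∘ f)` for a local inverse `σ` of `g`; continuity of `f` keeps its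
values on the sheet of `σ`. -/
theorem SmoothAt.of_localDiffeo_comp (hP : IsSmoothManifold P) {g : N → P}
    (hg : IsLocalDiffeo g) {f : M → N} {x : M} (hf : ContinuousAt f x)
    (h : SmoothAt (g ∘ f) x) : SmoothAt f x := by
  obtain ⟨σ, hσ, -, -, hσ'⟩ := hg.exists_section (f x)
  have := SmoothAt.comp hP (x := x) (f := g ∘ f) hσ h
  exact this.congr ((hf.eventually hσ').mono fun w hw => hw.symm)

theorem IsLocalDiffeo.submersionAt (hN : IsSmoothManifold N)
    {f : M → N} (hf : IsLocalDiffeo f) (x : M) : SubmersionAt f x := by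
  obtain ⟨σ, hσ, hσx, hσ', -⟩ := hf.exists_section x
  have h : SubmersionAt (f ∘ σ) (f x) := (submersionAt_id hN (f x)).congr hσ'
  have := SubmersionAt.of_comp hN h ((hf.smooth).smoothAt _) hσ
  rwa [hσx] at this

theorem SubmersionAt.of_localDiffeo_comp (hN : IsSmoothManifold N) (hP : IsSmoothManifold P)
    {g : N → P} (hg : IsLocalDiffeo g) {f : M → N} {x : M} (hf : ContinuousAt f x)
    (h : SubmersionAt (g ∘ f) x) : SubmersionAt f x := by
  obtain ⟨σ, hσ, hσx, -, hσ'⟩ := hg.exists_section (f x)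
  have h1 : SubmersionAt (σ ∘ g) (f x) := (submersionAt_id hN (f x)).congr hσ'
  have h2 : SubmersionAt σ (g (f x)) :=
    h1.of_comp hN hσ ((hg.smooth).smoothAt _)
  have := SubmersionAt.comp hP (x := x) (f := g ∘ f) h2 h
  exact this.congr ((hf.eventually hσ').mono fun w hw => hw.symm)

theorem IsLocalDiffeo.isSubmersion (hN : IsSmoothManifold N)
    {f : M → N} (hf : IsLocalDiffeo f) : IsSubmersion f :=
  isSubmersion_iff.2 (hf.submersionAt hN)

theorem Smooth.of_localDiffeo_comp (hP : IsSmoothManifold P) {g : N → P}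
    (hg : IsLocalDiffeo g) {f : M → N} (hf : Continuous f) (h : Smooth (g ∘ f)) : Smooth f :=
  smooth_iff.2 fun x => SmoothAt.of_localDiffeo_comp hP hg hf.continuousAt (h.smoothAt x)

theorem IsLocalDiffeo.comp_involution (hM : IsSmoothManifold M) {f : M → N}
    (hf : IsLocalDiffeo f) {i : M → M} (hi : Smooth i) (hii : Function.Involutive i) :
    IsLocalDiffeo (f ∘ i) := by
  intro x
  obtain ⟨e, hx, hfe, hes, hes'⟩ := hf (i x)
  let I : M ≃ₜ M :=
    { hii.toPerm with
      continuous_toFun := hi.continuous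
      continuous_invFun := hi.continuous }
  have hI : ∀ y, I y = i y := fun _ => rfl
  have hI' : ∀ y, I.symm y = i y := fun _ => rfl
  refine ⟨I.toOpenPartialHomeomorph.trans e, by simpa [hI] using hx, ?_, ?_, ?_⟩
  · intro y hy
    have : i y ∈ e.source := by simpa [hI] using hy
    simp [hI, hfe this]
  · refine (smoothOn_iff (OpenPartialHomeomorph.open_source _)).2 fun y hy => ?_
    have : i y ∈ e.source := by simpa [hI] using hy
    exact SmoothAt.comp hM (f := i) ((smoothOn_iff e.open_source).1 hes _ this) (hi.smoothAt y)
  · refine (smoothOn_iff (OpenPartialHomeomorph.open_target _)).2 fun y hy => ?_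
    have : y ∈ e.target := by simpa using hy
    exact SmoothAt.comp hM (g := i) (hi.smoothAt _) ((smoothOn_iff e.open_target).1 hes' _ this)

/-- Submersions are open maps. -/
theorem IsSubmersion.isOpenMap (hM : IsSmoothManifold M) (hN : IsSmoothManifold N) {f : M → N}
    (hf : IsSubmersion f) : IsOpenMap f := by
  refine IsOpenMap.of_nhds_le fun x => ?_
  obtain ⟨d, e, he, hes, hx⟩ := hM.exists_chart x
  obtain ⟨d', e', he', hes', hx'⟩ := hN.exists_chart (f x)
  have h := isSubmersion_iff.1 hf x
  have hcd := h.1.2 _ _ e he e' he' hx hx'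
  have hstrict := hcd.hasStrictFDerivAt (by simp)
  -- A map with surjective strict derivative is open at the point; the remaining lines carry this
  -- through the charts.
  have hmap := hstrict.map_nhds_eq_of_surj
    (LinearMap.range_eq_top.2 (h.2 _ _ e he e' he' hx hx'))
  have hp : (e' ∘ f ∘ e.symm) (e x) = e' (f x) := by simp [hx]
  rw [hp] at hmap
  have h1 : Filter.map e'.symm (𝓝 (e' (f x))) = 𝓝 (f x) := e'.symm_map_nhds_eq hx'
  have h2 : Filter.map e.symm (𝓝 (e x)) = 𝓝 x := e.symm_map_nhds_eq hx
  rw [← h1, ← hmap, ← h2, Filter.map_map, Filter.map_map]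
  refine le_of_eq (Filter.map_congr ?_)
  have hc := e.continuousAt_symm (e.map_source hx)
  rw [ContinuousAt, e.left_inv hx] at hc
  filter_upwards [hc.eventually (h.1.1.preimage_mem_nhds (e'.open_source.mem_nhds hx'))] with w hw
  have hw' : f (e.symm w) ∈ e'.source := hw
  simp [hw']

end Germs

/-! ### Pulled back atlases -/

section Pullback

variable {A M : Type u} [TopologicalSpace A] [Atlas M] {f : A → M}

/-- Transitions between pulled back charts are restrictions of transitions between charts of `M`. -/
theorem isSmoothManifold_pullback [T2Space A] [SecondCountableTopology A]
    (hM : IsSmoothManifold M) (hf : IsLocalHomeomorph f) :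
    @IsSmoothManifold A (Atlas.pullback f) := by
  let _ : Atlas A := Atlas.pullback f
  refine ⟨‹_›, ‹_›, fun a => ?_, fun d e he d' e' he' => ?_⟩
  · obtain ⟨d, c, hc, hac⟩ := hM.cover (f a)
    obtain ⟨g, hag, rfl⟩ := hf a
    refine ⟨d, g.trans c, ⟨c, hc, fun b hb => ?_⟩, ?_⟩
    · have hb' : b ∈ g.source ∧ g b ∈ c.source := by simpa using hb
      exact ⟨hb'.2, rfl⟩
    · simpa using ⟨hag, hac⟩
  · have key : ∀ {d d' : ℕ} {e : OpenPartialHomeomorph A (Euc d)}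
        {e' : OpenPartialHomeomorph A (Euc d')}, e ∈ Atlas.charts (M := A) d →
        e' ∈ Atlas.charts (M := A) d' →
        ContDiffOn ℝ ∞ (e' ∘ e.symm) (e.symm.trans e').source := by
      rintro d d' e e' ⟨c, hc, h⟩ ⟨c', hc', h'⟩
      have hcc := (hM.compatible d c hc d' c' hc').1
      have heq : ∀ v ∈ (e.symm.trans e').source, v ∈ c.target ∧ f (e.symm v) = c.symm v ∧
          f (e.symm v) ∈ c'.source ∧ e' (e.symm v) = c' (f (e.symm v)) := by
        intro v hv
        have hv' : v ∈ e.target ∧ e.symm v ∈ e'.source := by simpa using hv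
        obtain ⟨h1, h2⟩ := h _ (e.map_target hv'.1)
        obtain ⟨h3, h4⟩ := h' _ hv'.2
        rw [e.right_inv hv'.1] at h2
        refine ⟨?_, ?_, h3, h4⟩
        · rw [h2]; exact c.map_source h1
        · rw [h2, c.left_inv h1, ← h2]
      refine (hcc.mono fun v hv => ?_).congr fun v hv => ?_
      · obtain ⟨h1, h2, h3, -⟩ := heq v hv
        rw [h2] at h3
        simpa using ⟨h1, h3⟩
      · obtain ⟨-, h2, -, h4⟩ := heq v hv
        simp only [Function.comp_apply]
        rw [h4, h2]
    exact ⟨key he he', key he' he⟩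

/-- With the chart `c` on `M` and the chart `g.trans c` on `A`, both `f` and its local inverse read
as the identity. -/
theorem isLocalDiffeo_pullback [T2Space A] [SecondCountableTopology A]
    (hM : IsSmoothManifold M) (hf : IsLocalHomeomorph f) :
    @IsLocalDiffeo A M (Atlas.pullback f) _ f := by
  let _ : Atlas A := Atlas.pullback f
  have hA : IsSmoothManifold A := isSmoothManifold_pullback hM hf
  intro a
  obtain ⟨g, hag, hg⟩ := hf a
  have chart : ∀ b ∈ g.source, ∃ (d : ℕ) (e : OpenPartialHomeomorph A (Euc d))
      (c : OpenPartialHomeomorph M (Euc d)), IsSmoothChart e ∧ IsSmoothChart c ∧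
      e = g.trans c ∧ b ∈ e.source ∧ g b ∈ c.source := by
    intro b hb
    obtain ⟨d, c, hc, hbc⟩ := hM.cover (g b)
    refine ⟨d, g.trans c, c, hA.compatible _ _ ⟨c, hc, fun b hb => ?_⟩, hM.compatible _ _ hc, rfl,
      by simpa using ⟨hb, hbc⟩, hbc⟩
    have hb' : b ∈ g.source ∧ g b ∈ c.source := by simpa using hb
    exact ⟨by rw [hg]; exact hb'.2, by rw [hg]; rfl⟩
  refine ⟨g, hag, fun b _ => by rw [hg], ?_, ?_⟩
  · refine (smoothOn_iff g.open_source).2 fun b hb => ?_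
    obtain ⟨d, e, c, hes, hcs, rfl, hbe, hbc⟩ := chart b hb
    refine (smoothAt_iff hA hM hes hcs hbe hbc).2 ⟨g.continuousAt hb, ?_⟩
    refine contDiffAt_id.congr_of_eventuallyEq ?_
    filter_upwards [(g.trans c).open_target.mem_nhds ((g.trans c).map_source hbe)] with v hv
    exact (g.trans c).right_inv hv
  · refine (smoothOn_iff g.open_target).2 fun y hy => ?_
    obtain ⟨d, e, c, hes, hcs, rfl, hbe, hbc⟩ := chart _ (g.map_target hy)
    rw [g.right_inv hy] at hbc
    refine (smoothAt_iff hM hA hcs hes hbc hbe).2 ⟨g.continuousAt_symm hy, ?_⟩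
    refine contDiffAt_id.congr_of_eventuallyEq ?_
    have hc := c.continuousAt_symm (c.map_source hbc)
    rw [ContinuousAt, c.left_inv hbc] at hc
    filter_upwards [c.open_target.mem_nhds (c.map_source hbc),
      hc.eventually (g.open_target.mem_nhds hy)] with v hv hv'
    have hv' : c.symm v ∈ g.target := hv'
    simp [hv, hv']

end Pullback

/-! ### The one-point manifold -/

/-- The atlas of a point. -/
abbrev pointAtlas : Atlas PUnit.{u + 1} where
  charts _ := Set.univ

/-- Testing a fibred product on a point turns its universal property into a statement about single
arrows. -/
theorem isSmoothManifold_point : @IsSmoothManifold PUnit.{u + 1} pointAtlas := by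
  let _ : Atlas PUnit.{u + 1} := pointAtlas
  refine ⟨inferInstance, inferInstance, fun x => ⟨0, ?_⟩, fun d e _ d' e' _ => ⟨?_, ?_⟩⟩
  · let h : PUnit.{u + 1} ≃ₜ Euc 0 :=
      { toFun := fun _ => 0
        invFun := fun _ => PUnit.unit
        left_inv := fun _ => rfl
        right_inv := fun _ => Subsingleton.elim _ _ }
    exact ⟨h.toOpenPartialHomeomorph, trivial, trivial⟩
  · exact contDiffOn_const (c := e' PUnit.unit)
  · exact contDiffOn_const (c := e PUnit.unit)

theorem smooth_from_point {N : Type u} [Atlas N] (f : PUnit.{u + 1} → N) :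
    @Smooth PUnit.{u + 1} N pointAtlas _ f := by
  let _ : Atlas PUnit.{u + 1} := pointAtlas
  refine ⟨continuous_of_const (fun _ _ => rfl) |>.continuousOn, fun d d' e _ e' _ => ?_⟩
  exact contDiffOn_const (c := e' (f PUnit.unit))

/-! ### Base change of local homeomorphisms -/

/-- If `e` inverts `f` locally, then `x ↦ (e.symm (h x), x)` takes values in the fibre product and
inverts the second projection. -/
theorem isLocalHomeomorph_baseChange {A B X Z : Type*} [TopologicalSpace A] [TopologicalSpace B]
    [TopologicalSpace X] [TopologicalSpace Z] {f : A → B} (hf : IsLocalHomeomorph f) {h : X → B}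
    (hh : Continuous h) {j : Z → A × X} (hj : Topology.IsEmbedding j)
    (hr : Set.range j = {p | f p.1 = h p.2}) : IsLocalHomeomorph (fun z => (j z).2) := by
  have hz : ∀ z, f (j z).1 = h (j z).2 := fun z => by
    have : j z ∈ Set.range j := ⟨z, rfl⟩
    rwa [hr] at this
  refine IsLocalHomeomorph.mk _ fun z₀ => ?_
  obtain ⟨e, he, hfe⟩ := hf (j z₀).1
  -- Needed only for `Function.invFun`, whose default value is never met on the target.
  have : Nonempty Z := ⟨z₀⟩
  have hinv : ∀ x, h x ∈ e.target → j (Function.invFun j (e.symm (h x), x)) = (e.symm (h x), x) := by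
    intro x hx
    apply Function.invFun_eq
    have : (e.symm (h x), x) ∈ Set.range j := by
      rw [hr]
      simp only [Set.mem_ofPred_eq]
      rw [hfe, e.right_inv hx]
    exact this
  refine ⟨{ toFun := fun z => (j z).2
            invFun := fun x => Function.invFun j (e.symm (h x), x)
            source := {z | (j z).1 ∈ e.source}
            target := {x | h x ∈ e.target}
            map_source' := fun z hz' => ?_
            map_target' := fun x hx => ?_
            left_inv' := fun z hz' => ?_
            right_inv' := fun x hx => ?_
            open_source := e.open_source.preimage (continuous_fst.comp hj.continuous)
            open_target := e.open_target.preimage hh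
            continuousOn_toFun := (continuous_snd.comp hj.continuous).continuousOn
            continuousOn_invFun := ?_ }, he, fun _ _ => rfl⟩
  · simp only [Set.mem_ofPred_eq] at hz' ⊢
    rw [← hz z, hfe]
    exact e.map_source hz'
  · simp only [Set.mem_ofPred_eq] at hx ⊢
    rw [hinv x hx]
    exact e.map_target hx
  · apply hj.injective
    simp only [Set.mem_ofPred_eq] at hz'
    have h1 : e.symm (h (j z).2) = (j z).1 := by rw [← hz z, hfe, e.left_inv hz']
    rw [hinv _ (by rw [← hz z, hfe]; exact e.map_source hz'), h1]
  · simp only [Set.mem_ofPred_eq] at hx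
    rw [hinv x hx]
  · rw [hj.isInducing.continuousOn_iff]
    have : ContinuousOn (fun x => (e.symm (h x), x)) {x | h x ∈ e.target} :=
      (e.continuousOn_symm.comp hh.continuousOn fun x hx => hx).prodMk continuousOn_id
    exact this.congr fun x hx => hinv x hx

/-! ### Étale groupoids -/

section Etale

variable {G : ChartedGroupoid.{u}} {P : Type u} [Atlas P]

/-- Since the source map is a local diffeomorphism, a continuous family of arrows is as smooth as
its source. -/
theorem ChartedGroupoid.IsOrbifold.smooth_arrow (hG : G.IsOrbifold) {f : P → Arr G.Ob}
    (hc : Continuous f) (hs : Smooth (fun p => (f p).src)) : Smooth f :=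
  Smooth.of_localDiffeo_comp hG.manifold_ob hG.etale_src hc hs

theorem ChartedGroupoid.IsOrbifold.continuous_src (hG : G.IsOrbifold) :
    Continuous (fun a : Arr G.Ob => a.src) :=
  hG.etale_src.isLocalHomeomorph.continuous

theorem ChartedGroupoid.IsOrbifold.continuous_tgt (hG : G.IsOrbifold) :
    Continuous (fun a : Arr G.Ob => a.tgt) :=
  hG.etale_tgt.isLocalHomeomorph.continuous

/-- Pairs of composable arrows. -/
abbrev ComposablePair (C : Type u) [Groupoid.{u} C] : Type u :=
  {p : Arr C × Arr C // p.1.tgt = p.2.src}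

/-- Composition of arrows is continuous. -/
theorem ChartedGroupoid.IsOrbifold.exists_nhds_comp (hG : G.IsOrbifold) {x y z : G.Ob}
    (f : x ⟶ y) (g : y ⟶ z) {W : Set (Arr G.Ob)} (hW : W ∈ 𝓝 (⟨x, z, f ≫ g⟩ : Arr G.Ob)) :
    ∃ A ∈ 𝓝 (⟨x, y, f⟩ : Arr G.Ob), ∃ B ∈ 𝓝 (⟨y, z, g⟩ : Arr G.Ob),
      ∀ {x' y' z' : G.Ob} (f' : x' ⟶ y') (g' : y' ⟶ z'), (⟨x', y', f'⟩ : Arr G.Ob) ∈ A →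
        (⟨y', z', g'⟩ : Arr G.Ob) ∈ B → (⟨x', z', f' ≫ g'⟩ : Arr G.Ob) ∈ W := by
  have := hG.manifold_ar.t2
  have := hG.manifold_ar.secondCountable
  -- Composition is only known to be smooth on families over manifolds. The composable pairs
  -- themselves become such a manifold, étale over the second arrow, and carry the universal family.
  have hloc : IsLocalHomeomorph (fun p : ComposablePair G.Ob => p.1.2) :=
    isLocalHomeomorph_baseChange hG.etale_tgt.isLocalHomeomorph hG.continuous_src
      (j := fun p : ComposablePair G.Ob => p.1) Topology.IsEmbedding.subtypeVal (by
        ext p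
        simp)
  have : SecondCountableTopology (ComposablePair G.Ob) :=
    Topology.IsEmbedding.subtypeVal.secondCountableTopology
  let _ : Atlas (ComposablePair G.Ob) := Atlas.pullback (fun p : ComposablePair G.Ob => p.1.2)
  have hC : IsSmoothManifold (ComposablePair G.Ob) := isSmoothManifold_pullback hG.manifold_ar hloc
  have hd : IsLocalDiffeo (fun p : ComposablePair G.Ob => p.1.2) := isLocalDiffeo_pullback hG.manifold_ar hloc
  have hsnd : Smooth (fun p : ComposablePair G.Ob => p.1.2) := hd.smooth
  have hfst : Smooth (fun p : ComposablePair G.Ob => p.1.1) := by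
    -- The target of the first arrow is the source of the second, and the target map is a local
    -- diffeomorphism.
    refine Smooth.of_localDiffeo_comp hG.manifold_ob hG.etale_tgt
      (continuous_fst.comp continuous_subtype_val) ?_
    have : (fun a : Arr G.Ob => a.tgt) ∘ (fun p : ComposablePair G.Ob => p.1.1) =
        (fun a : Arr G.Ob => a.src) ∘ (fun p : ComposablePair G.Ob => p.1.2) := by
      ext p
      exact p.2
    rw [this]
    exact hG.submersion_src.1.comp hG.manifold_ar hsnd
  have key := hG.smooth_comp (ComposablePair G.Ob) hC (fun p => p.1.1.src) (fun p => p.1.1.tgt) (fun p => p.1.2.tgt)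
    (fun p => p.1.1.hom) (fun p => eqToHom p.2 ≫ p.1.2.hom) hfst (by
      convert hsnd using 2 with p
      obtain ⟨⟨⟨a, b, f⟩, ⟨b', c, g⟩⟩, hp⟩ := p
      dsimp at hp
      subst hp
      simp)
  have hcont := key.continuous.continuousAt (x := ⟨(⟨x, y, f⟩, ⟨y, z, g⟩), rfl⟩)
  have hmem := hcont.preimage_mem_nhds (t := W) (by simpa using hW)
  rw [nhds_subtype_eq_comap, Filter.mem_comap] at hmem
  obtain ⟨T, hT, hTW⟩ := hmem
  rw [nhds_prod_eq, Filter.mem_prod_iff] at hT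
  obtain ⟨A, hA, B, hB, hAB⟩ := hT
  refine ⟨A, hA, B, hB, fun {x' y' z'} f' g' hf' hg' => ?_⟩
  have := @hTW ⟨(⟨x', y', f'⟩, ⟨y', z', g'⟩), rfl⟩ (hAB ⟨hf', hg'⟩)
  simpa using this

/-- The isotropy groups of an orbifold groupoid are finite. -/
theorem ChartedGroupoid.IsOrbifold.finite_isotropy (hG : G.IsOrbifold) (x : G.Ob) :
    Finite (End x) := by
  -- The isotropy arrows form a compact set; finitely many sheets of the source map cover it, and
  -- each sheet contains at most one arrow with source `x`.
  have hK := hG.proper.isCompact_preimage (isCompact_singleton (x := (x, x)))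
  choose e he hfe using hG.etale_src.isLocalHomeomorph
  obtain ⟨t, -, ht⟩ := hK.elim_nhds_subcover (fun a => (e a).source)
    (fun a _ => (e a).open_source.mem_nhds (he a))
  have hinj : Function.Injective (fun k : End x => (⟨x, x, k⟩ : Arr G.Ob)) := by
    intro k k' h
    simpa using h
  have hcov : ∀ k : End x, ∃ a ∈ t, (⟨x, x, k⟩ : Arr G.Ob) ∈ (e a).source := fun k => by
    simpa using ht (show (⟨x, x, k⟩ : Arr G.Ob) ∈ _ by simp)
  choose a hat hka using hcov
  refine Finite.of_injective (fun k => (⟨a k, hat k⟩ : t)) fun k k' h => hinj ?_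
  have hkk : a k = a k' := by simpa using h
  have hk' := hka k'
  rw [← hkk] at hk'
  refine (e (a k)).injOn (hka k) hk' ?_
  rw [← hfe]

/-- A linearisable neighbourhood before linearisation: an open neighbourhood `U` of `x` such that
the restriction of `G` to `U` is the action groupoid of an action `τ` of `G_x` on `U`. -/
structure LocalAction (G : ChartedGroupoid.{u}) (x : G.Ob) where
  U : Set G.Ob
  isOpen_U : IsOpen U
  mem_U : x ∈ U
  ξ : Arr G.Ob → End x
  τ : End x → G.Ob → G.Ob
  ξ_comp : ∀ {y z w : G.Ob}, y ∈ U → z ∈ U → w ∈ U →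
    ∀ (f : y ⟶ z) (g : z ⟶ w), ξ ⟨y, w, f ≫ g⟩ = ξ ⟨z, w, g⟩ * ξ ⟨y, z, f⟩
  ξ_isotropy : ∀ k : End x, ξ ⟨x, x, k⟩ = k
  ξ_bijective : ∀ y ∈ U, ∀ k : End x,
    ∃! a : (z : G.Ob) × (y ⟶ z), a.1 ∈ U ∧ ξ ⟨y, a.1, a.2⟩ = k
  ξ_locallyConstant : ∀ k : End x, IsOpen {a : Arr G.Ob | a.src ∈ U ∧ a.tgt ∈ U ∧ ξ a = k}
  τ_eq : ∀ {y z : G.Ob}, y ∈ U → z ∈ U → ∀ f : y ⟶ z, τ (ξ ⟨y, z, f⟩) y = z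
  τ_smooth : ∀ k, ∀ y ∈ U, SmoothAt (τ k) y

/-- Each of the finitely many isotropy elements `k` extends to a local section `σ k` of the source
map, with values in pairwise disjoint sheets `W k`. Properness forces every arrow between points
near `x` into one of these sheets, and `ξ` is the label of the sheet. Continuity of composition
makes the labels multiplicative. -/
theorem ChartedGroupoid.IsOrbifold.exists_localAction (hG : G.IsOrbifold) (x : G.Ob)
    {O : Set G.Ob} (hO : O ∈ 𝓝 x) : ∃ A : LocalAction G x, A.U ⊆ O := by
  classical
  have := hG.finite_isotropy x
  have := hG.manifold_ar.t2
  let I : End x → Arr G.Ob := fun k => ⟨x, x, k⟩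
  have hI : Function.Injective I := fun k k' h => by simpa [I] using h
  obtain ⟨D, hD, hdisj⟩ := (Set.finite_range I).t2_separation
  choose e he hfe hes hes' using hG.etale_src
  let W : End x → Set (Arr G.Ob) := fun k => (e (I k)).source ∩ D (I k)
  have hWo : ∀ k, IsOpen (W k) := fun k => (e (I k)).open_source.inter (hD _).2
  have hIW : ∀ k, I k ∈ W k := fun k => ⟨he _, (hD _).1⟩
  have hWinj : ∀ k, ∀ a ∈ W k, ∀ b ∈ W k, a.src = b.src → a = b := fun k a ha b hb hab =>
    (e (I k)).injOn ha.1 hb.1 (by rw [← hfe _ ha.1, ← hfe _ hb.1]; exact hab)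
  have hWdisj : ∀ k k' a, a ∈ W k → a ∈ W k' → k = k' := by
    intro k k' a ha ha'
    by_contra hne
    exact Set.disjoint_left.1 (hdisj ⟨k, rfl⟩ ⟨k', rfl⟩ (hI.ne hne)) ha.2 ha'.2
  let σ : End x → G.Ob → Arr G.Ob := fun k => (e (I k)).symm
  have htgt : ∀ k, x ∈ (e (I k)).target := fun k => by
    have := (e (I k)).map_source (he (I k))
    rwa [← hfe _ (he _)] at this
  have hσ_src : ∀ k, ∀ y ∈ (e (I k)).target, (σ k y).src = y := fun k y hy => by
    have := hfe _ ((e (I k)).map_target hy)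
    rw [(e (I k)).right_inv hy] at this
    exact this
  have hσx : ∀ k, σ k x = I k := fun k => by
    have := (e (I k)).left_inv (he (I k))
    rwa [← hfe _ (he _)] at this
  have hσc : ∀ k, ContinuousAt (σ k) x := fun k => (e (I k)).continuousAt_symm (htgt k)
  let τ : End x → G.Ob → G.Ob := fun k y => (σ k y).tgt
  have hτs : ∀ k, ∀ y ∈ (e (I k)).target, SmoothAt (τ k) y := fun k y hy =>
    SmoothAt.comp hG.manifold_ar (hG.submersion_tgt.1.smoothAt _)
      ((smoothOn_iff (e (I k)).open_target).1 (hes' _) y hy)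
  -- arrows between points near `x` lie in one of the `W k`
  have hnear : ∃ U₀ ∈ 𝓝 x, ∀ a : Arr G.Ob, a.src ∈ U₀ → a.tgt ∈ U₀ → ∃ k, a ∈ W k := by
    -- Proper maps are closed, so the endpoint pairs of arrows outside all sheets form a closed set,
    -- and it misses `(x, x)`.
    have hcl := hG.proper.isClosedMap _ (isOpen_iUnion hWo).isClosed_compl
    have hx : (x, x) ∈ ((fun a : Arr G.Ob => (a.src, a.tgt)) '' (⋃ k, W k)ᶜ)ᶜ := by
      rintro ⟨⟨a, b, k⟩, ha, hab⟩
      simp only [Prod.mk.injEq] at hab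
      obtain ⟨rfl, rfl⟩ := hab
      exact ha (Set.mem_iUnion.2 ⟨k, hIW k⟩)
    have := hcl.isOpen_compl.mem_nhds hx
    rw [nhds_prod_eq, Filter.mem_prod_iff] at this
    obtain ⟨A, hA, B, hB, hAB⟩ := this
    refine ⟨A ∩ B, Filter.inter_mem hA hB, fun a ha hb => ?_⟩
    by_contra hne
    have h1 : (a.src, a.tgt) ∈ A ×ˢ B := ⟨ha.1, hb.2⟩
    exact hAB h1 ⟨a, fun h => hne (Set.mem_iUnion.1 h), rfl⟩
  obtain ⟨U₀, hU₀, hcov⟩ := hnear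
  -- The composable arrows are quantified over and then identified with values of `σ`, which avoids
  -- transporting along equalities of endpoints.
  have hmul : ∀ k l : End x, ∀ᶠ y in 𝓝 x, ∀ {y' z w : G.Ob} (f : y' ⟶ z) (g : z ⟶ w),
      (⟨y', z, f⟩ : Arr G.Ob) = σ l y → (⟨z, w, g⟩ : Arr G.Ob) = σ k (τ l y) →
        (⟨y', w, f ≫ g⟩ : Arr G.Ob) ∈ W (k * l) := by
    intro k l
    obtain ⟨A, hA, B, hB, hAB⟩ := hG.exists_nhds_comp (x := x) (y := x) (z := x) l k
      ((hWo (k * l)).mem_nhds (hIW (k * l)))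
    have hτx : τ l x = x := by simp only [τ]; rw [hσx]
    have h1 : ∀ᶠ y in 𝓝 x, σ l y ∈ A := by
      refine (hσc l).preimage_mem_nhds ?_
      rw [hσx]
      exact hA
    have h2 : ∀ᶠ y in 𝓝 x, σ k (τ l y) ∈ B := by
      have hc : ContinuousAt (fun y => σ k (τ l y)) x :=
        ContinuousAt.comp (by rw [hτx]; exact hσc k) (hτs l x (htgt l)).1
      refine hc.preimage_mem_nhds ?_
      rw [hτx, hσx]
      exact hB
    filter_upwards [h1, h2] with y hy1 hy2 y' z w f g hf hg
    exact hAB f g (hf ▸ hy1) (hg ▸ hy2)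
  have hgood : ∀ᶠ y in 𝓝 x, y ∈ O ∧ y ∈ U₀ ∧ (∀ k, y ∈ (e (I k)).target) ∧ (∀ k, σ k y ∈ W k) ∧
      ∀ k l, ∀ {y' z w : G.Ob} (f : y' ⟶ z) (g : z ⟶ w),
      (⟨y', z, f⟩ : Arr G.Ob) = σ l y → (⟨z, w, g⟩ : Arr G.Ob) = σ k (τ l y) →
        (⟨y', w, f ≫ g⟩ : Arr G.Ob) ∈ W (k * l) := by
    refine (Filter.eventually_mem_set.2 hO).and <| (Filter.eventually_mem_set.2 hU₀).and <|
      (Filter.eventually_all.2 fun k => (e (I k)).open_target.mem_nhds (htgt k)).and <|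
      (Filter.eventually_all.2 fun k => (hσc k).preimage_mem_nhds ?_).and <|
      Filter.eventually_all.2 fun k => Filter.eventually_all.2 fun l => hmul k l
    rw [hσx]
    exact (hWo k).mem_nhds (hIW k)
  obtain ⟨U₂, hU₂, hU₂o, hxU₂⟩ := eventually_nhds_iff.1 hgood
  have hτmul : ∀ k l, ∀ y ∈ U₂, τ l y ∈ U₂ → σ (k * l) y ∈ W (k * l) ∧
      τ k (τ l y) = τ (k * l) y := by
    intro k l y hy hly
    obtain ⟨-, -, h3, h4, h5⟩ := hU₂ y hy
    have h3' := (hU₂ _ hly).2.2.1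
    refine ⟨h4 _, ?_⟩
    have hs1 := hσ_src l y (h3 l)
    have hs2 := hσ_src k _ (h3' k)
    rcases hf : σ l y with ⟨a, b, f⟩
    rcases hg : σ k (τ l y) with ⟨b', c, g⟩
    have hb : τ l y = b := by simp only [τ]; rw [hf]
    have hb' : b' = b := by rw [hg] at hs2; exact hs2.trans hb
    subst hb'
    have hW := h5 k l f g hf.symm hg.symm
    have := hWinj _ _ hW _ (h4 (k * l)) (by rw [hσ_src _ _ (h3 _)]; rw [hf] at hs1; exact hs1)
    have h6 : τ (k * l) y = c := by simp only [τ]; rw [← this]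
    rw [h6]
    show (σ k (τ l y)).tgt = c
    rw [hg]
  -- Keeping the points whose translates all stay in `U₂` gives an invariant set, because `τ k (τ l
  -- y) = τ (k * l) y` there.
  let U : Set G.Ob := {y | y ∈ U₂ ∧ ∀ k, τ k y ∈ U₂}
  have hUo : IsOpen U := by
    have : U = ⋂ k, (U₂ ∩ τ k ⁻¹' U₂) := by
      ext y
      simp only [U, Set.mem_ofPred_eq, Set.mem_iInter, Set.mem_inter_iff, Set.mem_preimage]
      exact ⟨fun h k => ⟨h.1, h.2 k⟩, fun h => ⟨(h 1).1, fun k => (h k).2⟩⟩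
    rw [this]
    refine isOpen_iInter_of_finite fun k => ContinuousOn.isOpen_inter_preimage ?_ hU₂o hU₂o
    exact fun y hy => (hτs k y ((hU₂ y hy).2.2.1 k)).1.continuousWithinAt
  have hxU : x ∈ U := ⟨hxU₂, fun k => by
    have : τ k x = x := by simp only [τ]; rw [hσx]
    rwa [this]⟩
  have hτU : ∀ k, ∀ y ∈ U, τ k y ∈ U := fun k y hy => ⟨hy.2 k, fun l => by
    rw [(hτmul l k y hy.1 (hy.2 k)).2]
    exact hy.2 _⟩
  have hex : ∀ a : Arr G.Ob, a.src ∈ U → a.tgt ∈ U → ∃ k, a ∈ W k := fun a ha hb =>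
    hcov a (hU₂ _ ha.1).2.1 (hU₂ _ hb.1).2.1
  -- The default `1` is irrelevant: arrows between points of `U` always lie in a sheet, and in only
  -- one.
  let ξ : Arr G.Ob → End x := fun a => if h : ∃ k, a ∈ W k then h.choose else 1
  have hξ : ∀ k a, a ∈ W k → ξ a = k := by
    intro k a ha
    have h : ∃ k, a ∈ W k := ⟨k, ha⟩
    simp only [ξ, dif_pos h]
    exact hWdisj _ _ a h.choose_spec ha
  have hξW : ∀ a : Arr G.Ob, a.src ∈ U → a.tgt ∈ U → a ∈ W (ξ a) := by
    intro a ha hb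
    obtain ⟨k, hk⟩ := hex a ha hb
    rwa [hξ k a hk]
  have hξσ : ∀ a : Arr G.Ob, a.src ∈ U → a.tgt ∈ U → a = σ (ξ a) a.src := by
    intro a ha hb
    refine hWinj (ξ a) a (hξW a ha hb) _ ((hU₂ _ ha.1).2.2.2.1 _) ?_
    rw [hσ_src _ _ ((hU₂ _ ha.1).2.2.1 _)]
  refine ⟨{ U := U, isOpen_U := hUo, mem_U := hxU, ξ := ξ, τ := τ
            ξ_comp := ?_, ξ_isotropy := fun k => hξ k _ (hIW k), ξ_bijective := ?_
            ξ_locallyConstant := ?_, τ_eq := ?_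
            τ_smooth := fun k y hy => hτs k y ((hU₂ y hy.1).2.2.1 k) },
          fun y hy => (hU₂ y hy.1).1⟩
  · intro y z w hy hz hw f g
    refine hξ _ _ ((hU₂ y hy.1).2.2.2.2 _ _ f g (hξσ _ hy hz) ?_)
    have h1 : τ (ξ ⟨y, z, f⟩) y = z := by
      have := hξσ ⟨y, z, f⟩ hy hz
      simp only [τ]
      rw [← this]
    rw [h1]
    exact hξσ ⟨z, w, g⟩ hz hw
  · intro y hy k
    have hsrc := hσ_src k y ((hU₂ y hy.1).2.2.1 k)
    have hW := (hU₂ y hy.1).2.2.2.1 k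
    have hU := hτU k y hy
    simp only [τ] at hU
    rcases hf : σ k y with ⟨y', z, f⟩
    rw [hf] at hsrc hW hU
    dsimp at hsrc hU
    subst hsrc
    refine ⟨⟨z, f⟩, ⟨hU, hξ k _ hW⟩, ?_⟩
    rintro ⟨z', f'⟩ ⟨hz', hk⟩
    dsimp at hz' hk
    have := hξσ ⟨_, z', f'⟩ hy hz'
    rw [hk] at this
    dsimp at this
    rw [hf] at this
    obtain ⟨-, h2, h3⟩ := Arr.mk.inj this
    subst h2
    rw [eq_of_heq h3]
  · intro k
    have : {a : Arr G.Ob | a.src ∈ U ∧ a.tgt ∈ U ∧ ξ a = k} =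
        ((fun a : Arr G.Ob => a.src) ⁻¹' U ∩ (fun a : Arr G.Ob => a.tgt) ⁻¹' U) ∩ W k := by
      ext a
      constructor
      · rintro ⟨h1, h2, rfl⟩
        exact ⟨⟨h1, h2⟩, hξW a h1 h2⟩
      · rintro ⟨⟨h1, h2⟩, h3⟩
        exact ⟨h1, h2, hξ k a h3⟩
    rw [this]
    exact ((hUo.preimage hG.continuous_src).inter (hUo.preimage hG.continuous_tgt)).inter (hWo k)
  · intro y z hy hz f
    have := hξσ ⟨y, z, f⟩ hy hz
    simp only [τ]
    rw [← this]

end Etale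

/-! ### Local actions -/

namespace LocalAction

variable {G : ChartedGroupoid.{u}} {x : G.Ob} (A : LocalAction G x)

theorem exists_arrow {y : G.Ob} (hy : y ∈ A.U) (k : End x) :
    ∃ (z : G.Ob) (f : y ⟶ z), z ∈ A.U ∧ A.ξ ⟨y, z, f⟩ = k ∧ A.τ k y = z := by
  obtain ⟨⟨z, f⟩, ⟨hz, hk⟩, -⟩ := A.ξ_bijective y hy k
  dsimp at hz hk
  exact ⟨z, f, hz, hk, hk ▸ A.τ_eq hy hz f⟩

theorem τ_mem {y : G.Ob} (hy : y ∈ A.U) (k : End x) : A.τ k y ∈ A.U := by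
  obtain ⟨z, f, hz, -, h⟩ := A.exists_arrow hy k
  rwa [h]

theorem τ_mul {y : G.Ob} (hy : y ∈ A.U) (k l : End x) : A.τ (k * l) y = A.τ k (A.τ l y) := by
  obtain ⟨z, f, hz, hf, hz'⟩ := A.exists_arrow hy l
  obtain ⟨w, g, hw, hg, hw'⟩ := A.exists_arrow hz k
  have := A.τ_eq hy hw (f ≫ g)
  rw [A.ξ_comp hy hz hw, hf, hg] at this
  rw [this, hz', hw']

theorem τ_one {y : G.Ob} (hy : y ∈ A.U) : A.τ 1 y = y := by
  have h1 : A.ξ ⟨y, y, 𝟙 y⟩ = 1 := by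
    have := A.ξ_comp hy hy hy (𝟙 y) (𝟙 y)
    rw [Category.comp_id] at this
    -- The label of an identity is idempotent in a group, hence trivial.
    exact mul_eq_left.1 this.symm
  have := A.τ_eq hy hy (𝟙 y)
  rwa [h1] at this

theorem τ_base (k : End x) : A.τ k x = x := by
  have := A.τ_eq A.mem_U A.mem_U k
  rwa [A.ξ_isotropy] at this

variable {d : ℕ} {e : OpenPartialHomeomorph G.Ob (Euc d)}
  (he : e ∈ Atlas.charts (M := G.Ob) d) (hx : x ∈ e.source)

include he hx in
theorem fderiv_τ_mul (k l : End x) : fderiv ℝ (e ∘ A.τ (k * l) ∘ e.symm) (e x) =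
    (fderiv ℝ (e ∘ A.τ k ∘ e.symm) (e x)).comp (fderiv ℝ (e ∘ A.τ l ∘ e.symm) (e x)) := by
  have h1 := A.τ_smooth l x A.mem_U
  have h2 := A.τ_smooth k x A.mem_U
  have hb := A.τ_base l
  have hb' := A.τ_base k
  have h3 := fderiv_chart_comp (g := A.τ k) (f := A.τ l) (x := x) (by rwa [hb]) h1 he he he hx
    (by rwa [hb]) (by rwa [hb, hb'])
  rw [hb] at h3
  rw [← h3]
  refine Filter.EventuallyEq.fderiv_eq ?_
  have hc := e.continuousAt_symm (e.map_source hx)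
  rw [ContinuousAt, e.left_inv hx] at hc
  filter_upwards [hc.eventually (A.isOpen_U.mem_nhds A.mem_U)] with w hw
  have hw' : e.symm w ∈ A.U := hw
  simp only [Function.comp_apply]
  rw [A.τ_mul hw']

include hx in
theorem fderiv_τ_one :
    fderiv ℝ (e ∘ A.τ 1 ∘ e.symm) (e x) = ContinuousLinearMap.id ℝ (Euc d) := by
  rw [← fderiv_id (x := e x)]
  refine Filter.EventuallyEq.fderiv_eq ?_
  have hc := e.continuousAt_symm (e.map_source hx)
  rw [ContinuousAt, e.left_inv hx] at hc
  filter_upwards [hc.eventually (A.isOpen_U.mem_nhds A.mem_U),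
    e.open_target.mem_nhds (e.map_source hx)] with w hw hw2
  have hw' : e.symm w ∈ A.U := hw
  simp only [Function.comp_apply]
  rw [A.τ_one hw', e.right_inv hw2, id]

/-- The tangent representation of the isotropy group, read in a chart. -/
noncomputable def tangentRep : End x →* (Euc d →L[ℝ] Euc d) where
  toFun k := fderiv ℝ (e ∘ A.τ k ∘ e.symm) (e x)
  map_one' := A.fderiv_τ_one hx
  map_mul' k l := A.fderiv_τ_mul he hx k l

variable [Fintype (End x)]

/-- The average of the chart `e` over the action of the isotropy group. -/
noncomputable def average (y : G.Ob) : Euc d :=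
  (Fintype.card (End x) : ℝ)⁻¹ • ∑ k : End x, A.tangentRep he hx k⁻¹ (e (A.τ k y) - e x)

theorem average_base : A.average he hx x = 0 := by
  simp [average, A.τ_base]

/-- Substitute `k * h` for `k` in the sum and use `k⁻¹ = h * (k * h)⁻¹`. -/
theorem average_equivariant {y : G.Ob} (hy : y ∈ A.U) (h : End x) :
    A.average he hx (A.τ h y) = A.tangentRep he hx h (A.average he hx y) := by
  simp only [average, map_smul, map_sum]
  congr 1
  refine Fintype.sum_equiv (Equiv.mulRight h) _ _ fun k => ?_
  rw [Equiv.coe_mulRight, ← mul_apply_eq_comp, ← map_mul, A.τ_mul hy]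
  congr 3
  group

theorem contDiffAt_average (hU : A.U ⊆ e.source) {v : Euc d} (hv : v ∈ e.target)
    (hvU : e.symm v ∈ A.U) : ContDiffAt ℝ ∞ (A.average he hx ∘ e.symm) v := by
  have : A.average he hx ∘ e.symm = fun v => (Fintype.card (End x) : ℝ)⁻¹ •
      ∑ k : End x, A.tangentRep he hx k⁻¹ ((e ∘ A.τ k ∘ e.symm) v - e x) := rfl
  rw [this]
  refine ContDiffAt.const_smul _ (ContDiffAt.sum fun k _ => ?_)
  refine (ContinuousLinearMap.contDiff _).contDiffAt.comp _ (ContDiffAt.sub ?_ contDiffAt_const)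
  have := (A.τ_smooth k _ hvU).2 d d e he e he (e.map_target hv) (hU (A.τ_mem hvU k))
  rwa [e.right_inv hv] at this

/-- Every summand has derivative `T k⁻¹ ∘ T k = id`, where `T` is the tangent representation. Hence
the average is again a chart near `x`. -/
theorem hasFDerivAt_average (hU : A.U ⊆ e.source) :
    HasFDerivAt (A.average he hx ∘ e.symm) (ContinuousLinearMap.id ℝ (Euc d)) (e x) := by
  have : A.average he hx ∘ e.symm = fun v => (Fintype.card (End x) : ℝ)⁻¹ •
      ∑ k : End x, A.tangentRep he hx k⁻¹ ((e ∘ A.τ k ∘ e.symm) v - e x) := rfl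
  rw [this]
  have key : HasFDerivAt (fun v => (Fintype.card (End x) : ℝ)⁻¹ •
      ∑ k : End x, A.tangentRep he hx k⁻¹ ((e ∘ A.τ k ∘ e.symm) v - e x))
      ((Fintype.card (End x) : ℝ)⁻¹ • ∑ k : End x,
        (A.tangentRep he hx k⁻¹).comp (A.tangentRep he hx k)) (e x) := by
    refine HasFDerivAt.fun_const_smul (HasFDerivAt.fun_sum fun k _ => ?_) _
    refine (ContinuousLinearMap.hasFDerivAt _).comp _ (HasFDerivAt.sub_const _ ?_)
    have := (A.τ_smooth k x A.mem_U).2 d d e he e he hx (hU (A.τ_mem A.mem_U k))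
    exact (this.differentiableAt (by simp)).hasFDerivAt
  convert key using 1
  have h1 : ∀ k, (A.tangentRep he hx k⁻¹).comp (A.tangentRep he hx k) =
      ContinuousLinearMap.id ℝ (Euc d) := by
    intro k
    have : A.tangentRep he hx k⁻¹ * A.tangentRep he hx k = 1 := by
      rw [← map_mul, inv_mul_cancel, map_one]
    exact this
  simp only [h1]
  ext v
  simp

end LocalAction

/-! ### Linear algebra and local inverses -/

/-- The map `v ↦ (T k v)_k` into the orthogonal sum pulls back an invariant Euclidean norm; an
orthonormal basis of its image identifies this norm with the standard one. -/
theorem exists_invariant_norm {K : Type*} [Group K] [Finite K] {d : ℕ}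
    (T : K →* (Euc d →L[ℝ] Euc d)) :
    ∃ B : Euc d ≃L[ℝ] Euc d, ∀ k v, ‖B (T k v)‖ = ‖B v‖ := by
  cases nonempty_fintype K
  let J : Euc d →ₗ[ℝ] PiLp 2 (fun _ : K => Euc d) :=
    { toFun := fun v => WithLp.toLp 2 fun k => T k v
      map_add' := fun v w => by ext k; simp
      map_smul' := fun r v => by ext k; simp }
  have hJ : Function.Injective J := by
    intro v w h
    have := congrArg (fun u : PiLp 2 (fun _ : K => Euc d) => u 1) h
    simpa [J] using this
  let W := LinearMap.range J
  have hW : Module.finrank ℝ W = d := by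
    rw [LinearMap.finrank_range_of_inj hJ]
    simp
  let b := (stdOrthonormalBasis ℝ W).reindex (finCongr hW)
  let B : Euc d ≃ₗ[ℝ] Euc d := (LinearEquiv.ofInjective J hJ).trans b.repr.toLinearEquiv
  have hB : ∀ v, ‖B v‖ = ‖J v‖ := fun v => b.repr.norm_map _
  refine ⟨B.toContinuousLinearEquiv, fun h v => ?_⟩
  change ‖B (T h v)‖ = ‖B v‖
  rw [hB, hB, PiLp.norm_eq_of_L2, PiLp.norm_eq_of_L2]
  congr 1
  refine Fintype.sum_equiv (Equiv.mulRight h) _ _ fun k => ?_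
  simp [J]

theorem exists_local_inverse {d : ℕ} {f : Euc d → Euc d} {p : Euc d}
    (hf : ∀ᶠ v in 𝓝 p, ContDiffAt ℝ ∞ f v)
    (hd : HasFDerivAt f (ContinuousLinearMap.id ℝ (Euc d)) p) :
    ∃ g : OpenPartialHomeomorph (Euc d) (Euc d), p ∈ g.source ∧ (∀ v, g v = f v) ∧
      ContDiffOn ℝ ∞ g g.source ∧ ContDiffOn ℝ ∞ g.symm g.target := by
  have hfp := hf.self_of_nhds
  have hd' : HasFDerivAt f (ContinuousLinearEquiv.refl ℝ (Euc d) : Euc d →L[ℝ] Euc d) p := hd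
  let g₀ := hfp.toOpenPartialHomeomorph f hd' (by simp)
  have hp : p ∈ g₀.source := hfp.mem_toOpenPartialHomeomorph_source hd' (by simp)
  -- Smoothness of the inverse on its whole domain requires an invertible derivative at all nearby
  -- points, not only at `p`; invertibility is an open condition.
  have hinv : ∀ᶠ v in 𝓝 p, fderiv ℝ f v ∈
      Set.range (ContinuousLinearEquiv.toContinuousLinearMap (R₁ := ℝ) (R₂ := ℝ)
        (M₁ := Euc d) (M₂ := Euc d) (σ₁₂ := RingHom.id ℝ)) := by
    have hc : ContinuousAt (fderiv ℝ f) p :=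
      (hfp.fderiv_right (m := 0) (by simp)).continuousAt
    refine hc.preimage_mem_nhds ?_
    rw [hd.fderiv]
    exact (ContinuousLinearEquiv.refl ℝ (Euc d)).nhds
  obtain ⟨S, hS, hSo, hpS⟩ := eventually_nhds_iff.1 (hf.and hinv)
  refine ⟨g₀.restrOpen S hSo, ⟨hp, hpS⟩, fun v => rfl, fun v hv => ?_, fun w hw => ?_⟩
  · exact (hS v hv.2).1.contDiffWithinAt
  · have hw' := (g₀.restrOpen S hSo).map_target hw
    obtain ⟨h1, E, hE⟩ := hS _ hw'.2
    refine ContDiffAt.contDiffWithinAt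
      ((g₀.restrOpen S hSo).contDiffAt_symm (f₀' := E) hw ?_ h1)
    rw [hE]
    exact (h1.differentiableAt (by simp)).hasFDerivAt

theorem IsSmoothChart.trans {M : Type u} [Atlas M] {d d' : ℕ}
    {e : OpenPartialHomeomorph M (Euc d)} (he : IsSmoothChart e)
    {h : OpenPartialHomeomorph (Euc d) (Euc d')} (h1 : ContDiffOn ℝ ∞ h h.source)
    (h2 : ContDiffOn ℝ ∞ h.symm h.target) : IsSmoothChart (e.trans h) := by
  intro k c hc
  refine ⟨?_, ?_⟩
  · have : c ∘ (e.trans h).symm = (c ∘ e.symm) ∘ h.symm := rfl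
    rw [this]
    refine (he k c hc).1.comp (h2.mono fun v hv => ?_) fun v hv => ?_
    · simp only [OpenPartialHomeomorph.trans_source, OpenPartialHomeomorph.symm_source,
        OpenPartialHomeomorph.trans_target] at hv
      exact hv.1.1
    · simp only [OpenPartialHomeomorph.trans_source, OpenPartialHomeomorph.symm_source,
        OpenPartialHomeomorph.trans_target] at hv ⊢
      exact ⟨hv.1.2, hv.2⟩
  · have : (e.trans h) ∘ c.symm = h ∘ (e ∘ c.symm) := rfl
    rw [this]
    refine h1.comp ((he k c hc).2.mono fun v hv => ?_) fun v hv => ?_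
    · simp only [OpenPartialHomeomorph.trans_source, OpenPartialHomeomorph.symm_source] at hv ⊢
      exact ⟨hv.1, hv.2.1⟩
    · simp only [OpenPartialHomeomorph.trans_source] at hv
      exact hv.2.2

theorem IsSmoothChart.restrOpen {M : Type u} [Atlas M] {d : ℕ}
    {e : OpenPartialHomeomorph M (Euc d)} (he : IsSmoothChart e) {s : Set M} (hs : IsOpen s) :
    IsSmoothChart (e.restrOpen s hs) := by
  intro k c hc
  refine ⟨(he k c hc).1.mono fun v hv => ?_, (he k c hc).2.mono fun v hv => ?_⟩
  · simp only [OpenPartialHomeomorph.trans_source, OpenPartialHomeomorph.symm_source] at hv ⊢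
    exact ⟨hv.1.1, hv.2⟩
  · simp only [OpenPartialHomeomorph.trans_source, OpenPartialHomeomorph.symm_source] at hv ⊢
    exact ⟨hv.1, hv.2.1⟩

/-! ### Existence of linear charts -/

/-- The map rescales a vector by a factor depending only on its norm. -/
theorem univUnitBall_symm_equivariant {d : ℕ} (R : Euc d →L[ℝ] Euc d) {v : Euc d}
    (hv : ‖R v‖ = ‖v‖) :
    (OpenPartialHomeomorph.univUnitBall (E := Euc d)).symm (R v) =
      R ((OpenPartialHomeomorph.univUnitBall (E := Euc d)).symm v) := by
  change (√(1 - ‖R v‖ ^ 2))⁻¹ • R v = R ((√(1 - ‖v‖ ^ 2))⁻¹ • v)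
  rw [hv, map_smul]

/-- The averaged chart turns the local action into the tangent representation. A ball for an
invariant norm is then an invariant domain, and stretching it radially onto the whole space keeps
the action linear. -/
theorem ChartedGroupoid.IsOrbifold.nonempty_linearChart {G : ChartedGroupoid.{u}}
    (hG : G.IsOrbifold) (x : G.Ob) : Nonempty (LinearChart G x) := by
  have := hG.finite_isotropy x
  cases nonempty_fintype (End x)
  obtain ⟨d, e, he, hes, hx⟩ := hG.manifold_ob.exists_chart x
  obtain ⟨A, hAe⟩ := hG.exists_localAction x (e.open_source.mem_nhds hx)
  let T := A.tangentRep he hx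
  let ψ := A.average he hx
  obtain ⟨g, hgp, hgf, hg1, hg2⟩ := exists_local_inverse (f := ψ ∘ e.symm) (p := e x) (by
      have hc := e.continuousAt_symm (e.map_source hx)
      rw [ContinuousAt, e.left_inv hx] at hc
      filter_upwards [hc.eventually (A.isOpen_U.mem_nhds A.mem_U),
        e.open_target.mem_nhds (e.map_source hx)] with v hv hv'
      exact A.contDiffAt_average he hx hAe hv' hv) (A.hasFDerivAt_average he hx hAe)
  let E₁ : OpenPartialHomeomorph G.Ob (Euc d) := e.trans g
  have hE₁ : ∀ y ∈ e.source, E₁ y = ψ y := fun y hy => by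
    change g (e y) = ψ y
    rw [hgf, Function.comp_apply, e.left_inv hy]
  have hE₁s : IsSmoothChart E₁ := hes.trans hg1 hg2
  have hxE₁ : x ∈ E₁.source := by simpa [E₁] using ⟨hx, hgp⟩
  have hE₁e : E₁.source ⊆ e.source := fun y hy => by
    simp only [E₁, OpenPartialHomeomorph.trans_source] at hy
    exact hy.1
  obtain ⟨B₀, hB₀⟩ := exists_invariant_norm T
  -- an invariant neighbourhood of `x` on which the averaged chart is defined
  let U : Set G.Ob := {y | y ∈ A.U ∧ ∀ k, A.τ k y ∈ E₁.source}
  have hUo : IsOpen U := by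
    have : U = ⋂ k, (A.U ∩ A.τ k ⁻¹' E₁.source) := by
      ext y
      simp only [U, Set.mem_ofPred_eq, Set.mem_iInter, Set.mem_inter_iff, Set.mem_preimage]
      exact ⟨fun h k => ⟨h.1, h.2 k⟩, fun h => ⟨(h 1).1, fun k => (h k).2⟩⟩
    rw [this]
    refine isOpen_iInter_of_finite fun k =>
      ContinuousOn.isOpen_inter_preimage ?_ A.isOpen_U E₁.open_source
    exact fun y hy => (A.τ_smooth k y hy).1.continuousWithinAt
  have hxU : x ∈ U := ⟨A.mem_U, fun k => by rwa [A.τ_base]⟩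
  have hτU : ∀ y ∈ U, ∀ k, A.τ k y ∈ U := fun y hy k => ⟨A.τ_mem hy.1 k, fun l => by
    rw [← A.τ_mul hy.1]
    exact hy.2 _⟩
  have hUE : U ⊆ E₁.source := fun y hy => by
    have := hy.2 1
    rwa [A.τ_one hy.1] at this
  have hUψ : ∀ y ∈ U, E₁ y = ψ y := fun y hy => hE₁ y (hE₁e (hUE hy))
  have hE₁x : E₁ x = 0 := by rw [hUψ x hxU]; exact A.average_base he hx
  have himg : ∀ᶠ v in 𝓝 (0 : Euc d), v ∈ E₁.target ∧ E₁.symm v ∈ U := by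
    rw [← hE₁x]
    have hc := E₁.continuousAt_symm (E₁.map_source hxE₁)
    rw [ContinuousAt, E₁.left_inv hxE₁] at hc
    exact (E₁.open_target.eventually_mem (E₁.map_source hxE₁)).and
      (hc.eventually (hUo.eventually_mem hxU))
  have himg' : ∀ᶠ w in 𝓝 (0 : Euc d), B₀.symm w ∈ E₁.target ∧ E₁.symm (B₀.symm w) ∈ U := by
    have : Filter.Tendsto B₀.symm (𝓝 0) (𝓝 0) := by
      simpa using B₀.symm.continuous.tendsto 0
    exact this.eventually himg
  obtain ⟨r, hr, hball⟩ := Metric.eventually_nhds_iff_ball.1 himg'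
  -- The factor `r⁻¹` makes `‖B v‖ < 1` equivalent to `‖B₀ v‖ < r`, so the unit ball of the new norm
  -- lies in the image of `U`.
  let S : Euc d ≃ₗ[ℝ] Euc d := LinearEquiv.smulOfNeZero ℝ (Euc d) r⁻¹ (inv_ne_zero hr.ne')
  let B : Euc d ≃L[ℝ] Euc d := B₀.trans S.toContinuousLinearEquiv
  have hBapply : ∀ v, B v = r⁻¹ • B₀ v := fun v => rfl
  have hB : ∀ k v, ‖B (T k v)‖ = ‖B v‖ := fun k v => by
    rw [hBapply, hBapply, norm_smul, norm_smul, hB₀]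
  have hBball : ∀ v, ‖B v‖ < 1 → v ∈ E₁.target ∧ E₁.symm v ∈ U := by
    intro v hv
    have := hball (B₀ v) (by
      rw [hBapply, norm_smul, norm_inv, Real.norm_of_nonneg hr.le] at hv
      rw [mem_ball_zero_iff]
      rwa [inv_mul_lt_iff₀ hr, mul_one] at hv)
    rwa [B₀.symm_apply_apply] at this
  let D : OpenPartialHomeomorph (Euc d) (Euc d) := OpenPartialHomeomorph.univUnitBall
  let H : OpenPartialHomeomorph (Euc d) (Euc d) :=
    B.toHomeomorph.toOpenPartialHomeomorph.trans D.symm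
  have hHapply : ∀ v, H v = D.symm (B v) := fun v => rfl
  have hH : ∀ v, v ∈ H.source ↔ ‖B v‖ < 1 := by
    intro v
    have : v ∈ H.source ↔ B v ∈ Metric.ball (0 : Euc d) 1 := by
      simp only [H, OpenPartialHomeomorph.trans_source]
      exact ⟨fun h => h.2, fun h => ⟨trivial, h⟩⟩
    rw [this, mem_ball_zero_iff]
  let c : OpenPartialHomeomorph G.Ob (Euc d) := (E₁.trans H).restrOpen U hUo
  have hcU : ∀ y, y ∈ c.source ↔ y ∈ U ∧ ‖B (ψ y)‖ < 1 := by
    intro y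
    have : y ∈ c.source ↔ (y ∈ E₁.source ∧ E₁ y ∈ H.source) ∧ y ∈ U := by
      simp only [c, OpenPartialHomeomorph.restrOpen_source, OpenPartialHomeomorph.trans_source]
      rfl
    rw [this, hH]
    constructor
    · rintro ⟨⟨-, h2⟩, h3⟩
      rw [hUψ y h3] at h2
      exact ⟨h3, h2⟩
    · rintro ⟨h3, h2⟩
      exact ⟨⟨hUE h3, by rwa [hUψ y h3]⟩, h3⟩
  have hcapply : ∀ y ∈ c.source, c y = D.symm (B (ψ y)) := by
    intro y hy
    rw [← hUψ y ((hcU y).1 hy).1]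
    rfl
  have hcs : IsSmoothChart c := by
    refine (hE₁s.trans ?_ ?_).restrOpen hUo
    · have : ⇑H = D.symm ∘ B := rfl
      rw [this]
      refine OpenPartialHomeomorph.contDiffOn_univUnitBall_symm.comp
        B.contDiff.contDiffOn fun v hv => ?_
      rw [mem_ball_zero_iff]
      exact (hH v).1 hv
    · have : ⇑H.symm = B.symm ∘ D := rfl
      rw [this]
      exact (B.symm.contDiff.comp OpenPartialHomeomorph.contDiff_univUnitBall).contDiffOn
  have hτc : ∀ y ∈ c.source, ∀ k, A.τ k y ∈ c.source := fun y hy k => by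
    rw [hcU] at hy ⊢
    refine ⟨hτU y hy.1 k, ?_⟩
    rw [show ψ (A.τ k y) = T k (ψ y) from A.average_equivariant he hx hy.1.1 k, hB]
    exact hy.2
  have hψx : ψ x = 0 := A.average_base he hx
  have hxc : x ∈ c.source := (hcU x).2 ⟨hxU, by simp [hψx]⟩
  have hcA : c.source ⊆ A.U := fun y hy => ((hcU y).1 hy).1.1
  refine ⟨{
    dim := d, chart := c, smooth := hcs, mem_source := hxc, target_eq := ?_, chart_base := ?_
    rep :=
      { toFun := fun k => (B : Euc d →ₗ[ℝ] Euc d) ∘ₗ (T k : Euc d →ₗ[ℝ] Euc d) ∘ₗ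
          (B.symm : Euc d →ₗ[ℝ] Euc d)
        map_one' := by
          rw [map_one]
          ext1 v
          exact B.apply_symm_apply v
        map_mul' := fun k l => by
          rw [map_mul]
          ext1 v
          change B (T k (T l (B.symm v))) = B (T k (B.symm (B (T l (B.symm v)))))
          rw [B.symm_apply_apply] }
    ξ := fun {y z} f => A.ξ ⟨y, z, f⟩
    ξ_comp := fun hy hz hw f g => A.ξ_comp (hcA hy) (hcA hz) (hcA hw) f g
    ξ_isotropy := A.ξ_isotropy
    ξ_bijective := ?_
    ξ_locallyConstant := ?_
    equivariant := ?_ }⟩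
  · refine Set.eq_univ_of_forall fun w => ?_
    have hw : D w ∈ Metric.ball (0 : Euc d) 1 := D.map_source (x := w) trivial
    have hw' : ‖B (B.symm (D w))‖ < 1 := by
      rw [B.apply_symm_apply]
      exact mem_ball_zero_iff.1 hw
    obtain ⟨h1, h2⟩ := hBball _ hw'
    have h3 : ψ (E₁.symm (B.symm (D w))) = B.symm (D w) := by
      rw [← hUψ _ h2, E₁.right_inv h1]
    have h4 : E₁.symm (B.symm (D w)) ∈ c.source := (hcU _).2 ⟨h2, by rwa [h3]⟩
    have h5 := c.map_source h4
    rw [hcapply _ h4, h3, B.apply_symm_apply, D.left_inv (x := w) trivial] at h5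
    exact h5
  · rw [hcapply x hxc, hψx, map_zero]
    change (√(1 - ‖(0 : Euc d)‖ ^ 2))⁻¹ • (0 : Euc d) = 0
    rw [smul_zero]
  · intro y hy k
    obtain ⟨z, f, hz, hk, hτ⟩ := A.exists_arrow (hcA hy) k
    obtain ⟨a, -, ha⟩ := A.ξ_bijective y (hcA hy) k
    refine ⟨⟨z, f⟩, ⟨hτ ▸ hτc y hy k, hk⟩, fun b hb => ?_⟩
    rw [ha b ⟨hcA hb.1, hb.2⟩, ha ⟨z, f⟩ ⟨hz, hk⟩]
  · intro k
    have : {a : Arr G.Ob | a.src ∈ c.source ∧ a.tgt ∈ c.source ∧ A.ξ ⟨a.src, a.tgt, a.hom⟩ = k} =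
        ((fun a : Arr G.Ob => a.src) ⁻¹' c.source ∩ (fun a : Arr G.Ob => a.tgt) ⁻¹' c.source) ∩
          {a : Arr G.Ob | a.src ∈ A.U ∧ a.tgt ∈ A.U ∧ A.ξ a = k} := by
      ext a
      exact ⟨fun h => ⟨⟨h.1, h.2.1⟩, hcA h.1, hcA h.2.1, h.2.2⟩,
        fun h => ⟨h.1.1, h.1.2, h.2.2.2⟩⟩
    rw [this]
    exact ((c.open_source.preimage hG.continuous_src).inter
      (c.open_source.preimage hG.continuous_tgt)).inter (A.ξ_locallyConstant k)
  · intro y z hy hz f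
    have hz' := A.τ_eq (hcA hy) (hcA hz) f
    rw [hcapply y hy, hcapply z hz]
    set k := A.ξ ⟨y, z, f⟩
    -- The operator by which `k` acts in the final chart; it preserves the norm of `B (ψ y)`, as the
    -- radial stretching requires.
    let R : Euc d →L[ℝ] Euc d :=
      (B : Euc d →L[ℝ] Euc d).comp ((T k).comp (B.symm : Euc d →L[ℝ] Euc d))
    change D.symm (B (ψ z)) = R (D.symm (B (ψ y)))
    have hψz : ψ z = T k (ψ y) := by
      rw [← hz']
      exact A.average_equivariant he hx (hcA hy) k
    have hR : R (B (ψ y)) = B (ψ z) := by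
      change B (T k (B.symm (B (ψ y)))) = _
      rw [B.symm_apply_apply, hψz]
    rw [← hR]
    refine univUnitBall_symm_equivariant R ?_
    rw [hR, hψz, hB]

/-! ### The topology of the space of sectors -/

section SectorTopology

variable {Γ : Type u} [Group Γ] {G : ChartedGroupoid.{u}}

/-- The value of a sector at `γ`, as an arrow. -/
def Sector.ev (γ : Γ) (s : Sector Γ G) : Arr G.Ob := ⟨s.pt, s.pt, s.φ γ⟩

theorem Sector.ev_injective :
    Function.Injective (fun (s : Sector Γ G) (γ : Γ) => Sector.ev γ s) := by
  rintro ⟨x, φ⟩ ⟨y, ψ⟩ h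
  have h1 : ∀ γ, (⟨x, x, φ γ⟩ : Arr G.Ob) = ⟨y, y, ψ γ⟩ := fun γ => congrFun h γ
  obtain ⟨rfl, -⟩ := Arr.mk.inj (h1 1)
  congr 1
  ext γ
  simpa using h1 γ

namespace LinearChart

variable {x : G.Ob} (c : LinearChart G x) (φ : Γ →* End x)

/-- The arrows `s.φ γ` begin and end at `s.pt`, so equivariance of the chart makes `s.pt` a fixed
point of every `φ γ`. Injectivity of `ξ` on the isotropy group identifies the homomorphisms. -/
theorem exists_kappa_eq {s : Sector Γ G} (hs : s.pt ∈ c.chart.source)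
    (h : ∀ γ, c.ξ (s.φ γ) = φ γ) : ∃ y : c.fixedSet φ, y.1 = s.pt ∧ c.kappa φ y = s := by
  have hy : s.pt ∈ c.fixedSet φ := by
    refine ⟨hs, fun γ => ?_⟩
    rw [← h γ]
    exact (c.equivariant hs hs (s.φ γ)).symm
  refine ⟨⟨s.pt, hy⟩, rfl, ?_⟩
  obtain ⟨y, ψ⟩ := s
  simp only [kappa]
  congr 1
  ext γ
  apply c.ξAt_injective hs
  exact (c.ξ_lift φ hy γ).trans (h γ).symm

theorem mem_range_kappa {s : Sector Γ G} : s ∈ Set.range (c.kappa φ) ↔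
    s.pt ∈ c.chart.source ∧ ∀ γ, c.ξ (s.φ γ) = φ γ := by
  constructor
  · rintro ⟨y, rfl⟩
    exact ⟨y.2.1, c.ξ_lift φ y.2⟩
  · rintro ⟨h1, h2⟩
    obtain ⟨y, -, hy⟩ := c.exists_kappa_eq φ h1 h2
    exact ⟨y, hy⟩

/-- For finitely generated `Γ` this reduces membership to finitely many conditions, each of them
open. -/
theorem mem_range_kappa_of_generators {S : Set Γ} (hS : Subgroup.closure S = ⊤)
    {s : Sector Γ G} (hs : s.pt ∈ c.chart.source) (h : ∀ γ ∈ S, c.ξ (s.φ γ) = φ γ) :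
    s ∈ Set.range (c.kappa φ) := by
  refine (c.mem_range_kappa φ).2 ⟨hs, fun γ => ?_⟩
  have : (c.ξAt hs).comp s.φ = φ := MonoidHom.eq_of_eqOn_dense hS h
  exact DFunLike.congr_fun this γ

/-- The arrows over the domain of the chart on which `ξ` takes the value `k`. -/
def sheet (k : End x) : Set (Arr G.Ob) :=
  {a | a.src ∈ c.chart.source ∧ a.tgt ∈ c.chart.source ∧ c.ξ a.hom = k}

theorem isOpen_sheet (k : End x) : IsOpen (c.sheet k) := c.ξ_locallyConstant k

theorem sheet_injOn (k : End x) : Set.InjOn (fun a : Arr G.Ob => a.src) (c.sheet k) := by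
  rintro ⟨y, z, f⟩ ⟨h1, h2, h3⟩ ⟨y', z', f'⟩ ⟨h1', h2', h3'⟩ h
  dsimp at h h1 h2 h3 h1' h2' h3'
  subst h
  have := (c.ξ_bijective y h1 k).unique (y₁ := ⟨z, f⟩) (y₂ := ⟨z', f'⟩) ⟨h2, h3⟩ ⟨h2', h3'⟩
  obtain ⟨rfl, h4⟩ := Sigma.mk.inj this
  rw [eq_of_heq h4]

/-- Along `κ_φ` the value at `γ` stays in the sheet labelled `φ γ`, on which the source map is
injective and open. -/
theorem continuous_ev_kappa (hG : G.IsOrbifold) (γ : Γ) :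
    Continuous (fun y => Sector.ev γ (c.kappa φ y)) := by
  have hmem : ∀ y, Sector.ev γ (c.kappa φ y) ∈ c.sheet (φ γ) := fun y =>
    ⟨y.2.1, y.2.1, c.ξ_lift φ y.2 γ⟩
  refine continuous_def.2 fun W hW => ?_
  have hopen := hG.etale_src.isLocalHomeomorph.isOpenMap _ (hW.inter (c.isOpen_sheet (φ γ)))
  have : (fun y => Sector.ev γ (c.kappa φ y)) ⁻¹' W = (Subtype.val : c.fixedSet φ → G.Ob) ⁻¹'
      ((fun a : Arr G.Ob => a.src) '' (W ∩ c.sheet (φ γ))) := by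
    ext y
    constructor
    · exact fun hy => ⟨_, ⟨hy, hmem y⟩, rfl⟩
    · rintro ⟨a, ⟨haW, ha⟩, hay⟩
      have := c.sheet_injOn (φ γ) ha (hmem y) hay
      rwa [this] at haW
  rw [this]
  exact hopen.preimage continuous_subtype_val

end LinearChart

theorem Sector.mem_range_kappa_self (s : Sector Γ G) (c : LinearChart G s.pt) :
    s ∈ Set.range (c.kappa s.φ) :=
  (c.mem_range_kappa s.φ).2 ⟨c.mem_source, fun γ => c.ξ_isotropy (s.φ γ)⟩

theorem Sector.isOpen_iff {U : Set (Sector Γ G)} : IsOpen U ↔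
    ∀ (x : G.Ob) (c : LinearChart G x) (φ : Γ →* End x), IsOpen (c.kappa φ ⁻¹' U) := by
  change IsOpen[Sector.topology Γ G] U ↔ _
  simp only [isOpen_iSup_iff, isOpen_coinduced]

theorem LinearChart.continuous_kappa {x : G.Ob} (c : LinearChart G x) (φ : Γ →* End x) :
    Continuous (c.kappa φ) :=
  continuous_def.2 fun _ hU => Sector.isOpen_iff.1 hU x c φ

theorem Sector.continuous_ev (hG : G.IsOrbifold) (γ : Γ) :
    Continuous (Sector.ev γ : Sector Γ G → Arr G.Ob) :=
  continuous_def.2 fun _ hW => Sector.isOpen_iff.2 fun _ c φ =>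
    hW.preimage (c.continuous_ev_kappa φ hG γ)

theorem Sector.continuous_pt (hG : G.IsOrbifold) :
    Continuous (fun s : Sector Γ G => s.pt) :=
  hG.continuous_src.comp (Sector.continuous_ev hG 1)

variable [Group.FG Γ]

/-- The topology on sectors is the topology of pointwise convergence of homomorphisms. -/
theorem Sector.isEmbedding_ev (hG : G.IsOrbifold) :
    Topology.IsEmbedding (fun (s : Sector Γ G) (γ : Γ) => Sector.ev γ s) := by
  refine ⟨⟨le_antisymm (continuous_pi fun γ => Sector.continuous_ev hG γ).le_induced ?_⟩,
    Sector.ev_injective⟩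
  obtain ⟨S, hS, hSf⟩ := Group.fg_iff.1 ‹Group.FG Γ›
  intro U hU
  -- From here on the sectors carry the topology of pointwise convergence, in which `U` has to be
  -- shown open.
  let _ : TopologicalSpace (Sector Γ G) :=
    TopologicalSpace.induced (fun (s : Sector Γ G) (γ : Γ) => Sector.ev γ s) inferInstance
  change IsOpen U
  have hev : ∀ γ : Γ, Continuous (Sector.ev γ : Sector Γ G → Arr G.Ob) := fun γ =>
    (continuous_apply γ).comp
      (continuous_induced_dom (f := fun (s : Sector Γ G) (γ : Γ) => Sector.ev γ s))
  have hpt : Continuous (fun s : Sector Γ G => s.pt) := hG.continuous_src.comp (hev 1)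
  refine isOpen_iff_forall_mem_open.2 fun s hs => ?_
  obtain ⟨c⟩ := hG.nonempty_linearChart s.pt
  have hU' := Sector.isOpen_iff.1 hU s.pt c s.φ
  obtain ⟨V, hV, hVU⟩ := isOpen_induced_iff.1 hU'
  have hmem := (c.mem_range_kappa s.φ).1 (s.mem_range_kappa_self c)
  -- The sheet conditions on the generators put a sector in the image of `κ`; the condition that its
  -- point lies in `V` then puts it in `U`.
  refine ⟨(((fun s : Sector Γ G => s.pt) ⁻¹' c.chart.source) ∩
    ⋂ γ ∈ S, Sector.ev γ ⁻¹' (c.sheet (s.φ γ))) ∩ ((fun s : Sector Γ G => s.pt) ⁻¹' V),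
    ?_, ?_, ⟨⟨hmem.1, ?_⟩, ?_⟩⟩
  · rintro s' ⟨⟨h1, h2⟩, h3⟩
    obtain ⟨y, rfl⟩ := c.mem_range_kappa_of_generators s.φ hS h1
      fun γ hγ => (Set.mem_iInter₂.1 h2 γ hγ).2.2
    have h4 : y ∈ Subtype.val ⁻¹' V := h3
    rwa [hVU] at h4
  · exact ((c.chart.open_source.preimage hpt).inter
      (hSf.isOpen_biInter fun γ _ => (c.isOpen_sheet _).preimage (hev γ))).inter (hV.preimage hpt)
  · exact Set.mem_iInter₂.2 fun γ _ => ⟨hmem.1, hmem.1, hmem.2 γ⟩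
  · obtain ⟨y, hy, hys⟩ := c.exists_kappa_eq s.φ hmem.1 hmem.2
    have h4 : y ∈ c.kappa s.φ ⁻¹' U := by
      rw [Set.mem_preimage, hys]
      exact hs
    rw [← hVU] at h4
    simpa [hy] using h4

theorem Sector.continuous_iff (hG : G.IsOrbifold) {P : Type*} [TopologicalSpace P]
    {h : P → Sector Γ G} : Continuous h ↔ ∀ γ, Continuous (fun p => Sector.ev γ (h p)) := by
  rw [(Sector.isEmbedding_ev hG).continuous_iff, continuous_pi_iff]
  rfl

theorem LinearChart.isOpen_range_kappa (hG : G.IsOrbifold) {x : G.Ob} (c : LinearChart G x)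
    (φ : Γ →* End x) : IsOpen (Set.range (c.kappa φ)) := by
  obtain ⟨S, hS, hSf⟩ := Group.fg_iff.1 ‹Group.FG Γ›
  have : Set.range (c.kappa φ) = ((fun s : Sector Γ G => s.pt) ⁻¹' c.chart.source) ∩
      ⋂ γ ∈ S, Sector.ev γ ⁻¹' (c.sheet (φ γ)) := by
    ext s
    constructor
    · intro h
      obtain ⟨h1, h2⟩ := (c.mem_range_kappa φ).1 h
      exact ⟨h1, Set.mem_iInter₂.2 fun γ _ => ⟨h1, h1, h2 γ⟩⟩
    · rintro ⟨h1, h2⟩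
      exact c.mem_range_kappa_of_generators φ hS h1
        fun γ hγ => (Set.mem_iInter₂.1 h2 γ hγ).2.2
  rw [this]
  exact (c.chart.open_source.preimage (Sector.continuous_pt hG)).inter
    (hSf.isOpen_biInter fun γ _ => (c.isOpen_sheet _).preimage (Sector.continuous_ev hG γ))

theorem countable_of_fg : Countable Γ := by
  obtain ⟨α, hα, f, hf⟩ := Group.fg_iff_exists_freeGroup_hom_surjective_finite.1 ‹Group.FG Γ›
  exact hf.countable

end SectorTopology

/-! ### The space of sectors is a manifold -/

section SectorManifold

variable {Γ : Type u} [Group Γ] {G : ChartedGroupoid.{u}}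

/-- A chart of the space of sectors is, through the anchor map, the restriction of a linear
chart to a fixed-point subspace. -/
theorem Sector.chart_spec {d : ℕ} {e : OpenPartialHomeomorph (Sector Γ G) (Euc d)}
    (he : e ∈ Atlas.charts (M := Sector Γ G) d) :
    ∃ (x : G.Ob) (c : LinearChart G x) (φ : Γ →* End x) (L : Euc d →L[ℝ] Euc c.dim)
      (Q : Euc c.dim →L[ℝ] Euc d), (∀ v, Q (L v) = v) ∧
      (∀ w, w ∈ c.fixedSubspace φ ↔ w ∈ Set.range L) ∧ e.target = Set.univ ∧
      e.source = Set.range (c.kappa φ) ∧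
      (∀ s ∈ e.source, s.pt ∈ c.chart.source ∧ L (e s) = c.chart s.pt) ∧
      ∀ v, (e.symm v).pt = c.chart.symm (L v) := by
  obtain ⟨x, c, φ, L, ht, hsymm⟩ := he
  let L' : Euc d →ₗ[ℝ] Euc c.dim := (c.fixedSubspace φ).subtype ∘ₗ L.toLinearMap
  have hL' : ∀ v, L' v = L v := fun v => rfl
  obtain ⟨Q, hQ⟩ := L'.exists_leftInverse_of_injective (LinearMap.ker_eq_bot.2
    (Subtype.val_injective.comp L.injective))
  have hpt : ∀ v, (e.symm v).pt = c.chart.symm (L v) := fun v => by rw [hsymm]; rfl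
  have hct : ∀ w, w ∈ c.chart.target := fun w => by rw [c.target_eq]; trivial
  refine ⟨x, c, φ, LinearMap.toContinuousLinearMap L', LinearMap.toContinuousLinearMap Q,
    fun v => LinearMap.congr_fun hQ v, fun w => ?_, ht, ?_, fun s hs => ?_, hpt⟩
  · constructor
    · intro hw
      exact ⟨L.symm ⟨w, hw⟩, by simp [hL']⟩
    · rintro ⟨v, rfl⟩
      exact (L v).2
  · ext s
    constructor
    · intro hs
      rw [← e.left_inv hs, hsymm]
      exact ⟨_, rfl⟩
    · rintro ⟨y, rfl⟩
      have h1 : c.kappa φ y = e.symm (L.symm ⟨c.chart y, y.2.2⟩) := by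
        rw [hsymm]
        congr 1
        apply Subtype.ext
        simp [c.chart.left_inv y.2.1]
      rw [h1]
      exact e.map_target (by rw [ht]; trivial)
  · have h1 : s.pt = c.chart.symm (L' (e s)) := by
      have := hpt (e s)
      rwa [e.left_inv hs] at this
    rw [h1]
    exact ⟨c.chart.map_target (hct _), (c.chart.right_inv (hct _)).symm⟩

variable [Group.FG Γ]

theorem Sector.exists_chart (hG : G.IsOrbifold) (s : Sector Γ G) {x : G.Ob} (c : LinearChart G x)
    (φ : Γ →* End x) (hs : s ∈ Set.range (c.kappa φ)) :
    ∃ (d : ℕ), ∃ e ∈ Atlas.charts (M := Sector Γ G) d, s ∈ e.source := by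
  let L : Euc (Module.finrank ℝ (c.fixedSubspace φ)) ≃ₗ[ℝ] c.fixedSubspace φ :=
    LinearEquiv.ofFinrankEq _ _ (by simp)
  have hct : ∀ w, w ∈ c.chart.target := fun w => by rw [c.target_eq]; trivial
  have hrange : ∀ s ∈ Set.range (c.kappa φ), c.chart s.pt ∈ c.fixedSubspace φ := by
    rintro _ ⟨y, rfl⟩
    exact y.2.2
  have hinv : ∀ v : c.fixedSubspace φ, c.chart (c.chart.symm v) ∈ c.fixedSubspace φ := fun v => by
    rw [c.chart.right_inv (hct _)]
    exact v.2
  -- A linear projection onto the fixed subspace makes the chart a total function; its values off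
  -- the subspace do not matter.
  obtain ⟨Q, hQ⟩ := (c.fixedSubspace φ).subtype.exists_leftInverse_of_injective
    (LinearMap.ker_eq_bot.2 Subtype.val_injective)
  have hQ' : ∀ w (hw : w ∈ c.fixedSubspace φ), Q w = ⟨w, hw⟩ := fun w hw =>
    LinearMap.congr_fun hQ ⟨w, hw⟩
  let e : OpenPartialHomeomorph (Sector Γ G) (Euc (Module.finrank ℝ (c.fixedSubspace φ))) :=
    { toFun := fun s => L.symm (Q (c.chart s.pt))
      invFun := fun v => c.kappa φ ⟨c.chart.symm (L v), c.symm_mem_fixedSet φ (L v)⟩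
      source := Set.range (c.kappa φ)
      target := Set.univ
      map_source' := fun _ _ => trivial
      map_target' := fun v _ => ⟨_, rfl⟩
      left_inv' := by
        rintro _ ⟨y, rfl⟩
        congr 1
        apply Subtype.ext
        simp only [LinearEquiv.apply_symm_apply]
        rw [hQ' _ (hrange _ ⟨y, rfl⟩)]
        exact c.chart.left_inv y.2.1
      right_inv' := fun v _ => by
        simp only [LinearChart.kappa]
        rw [hQ' _ (hinv _), LinearEquiv.symm_apply_eq]
        exact Subtype.ext (c.chart.right_inv (hct _))
      open_source := c.isOpen_range_kappa hG φ
      open_target := isOpen_univ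
      continuousOn_toFun := by
        refine (L.symm.toLinearMap ∘ₗ Q).continuous_of_finiteDimensional.comp_continuousOn
          (c.chart.continuousOn.comp (Sector.continuous_pt hG).continuousOn ?_)
        rintro _ ⟨y, rfl⟩
        exact y.2.1
      continuousOn_invFun := by
        refine Continuous.continuousOn ((c.continuous_kappa φ).comp (Continuous.subtype_mk ?_ _))
        have h1 : Continuous (fun v => ((L v : c.fixedSubspace φ) : Euc c.dim)) :=
          continuous_subtype_val.comp L.toLinearMap.continuous_of_finiteDimensional
        exact c.chart.continuousOn_symm.comp_continuous h1 fun v => hct _ }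
  exact ⟨_, e, ⟨x, c, φ, L, rfl, fun v => rfl⟩, hs⟩

/-- The separation and countability axioms come from the embedding into a countable product of
copies of `G₁`. Transitions have the form `Q' ∘ (c'.chart ∘ c.chart.symm) ∘ L` with `L` and `Q'`
linear. -/
theorem Sector.isSmoothManifold (hG : G.IsOrbifold) : IsSmoothManifold (Sector Γ G) := by
  have := hG.manifold_ar.t2
  have := hG.manifold_ar.secondCountable
  have := countable_of_fg (Γ := Γ)
  refine ⟨(Sector.isEmbedding_ev hG).t2Space, (Sector.isEmbedding_ev hG).secondCountableTopology,
    fun s => ?_, fun d e he d' e' he' => ?_⟩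
  · obtain ⟨c⟩ := hG.nonempty_linearChart s.pt
    exact s.exists_chart hG c s.φ (s.mem_range_kappa_self c)
  · have key : ∀ {d d' : ℕ} {e : OpenPartialHomeomorph (Sector Γ G) (Euc d)}
        {e' : OpenPartialHomeomorph (Sector Γ G) (Euc d')},
        e ∈ Atlas.charts (M := Sector Γ G) d → e' ∈ Atlas.charts (M := Sector Γ G) d' →
        ContDiffOn ℝ ∞ (e' ∘ e.symm) (e.symm.trans e').source := by
      intro d d' e e' he he'
      obtain ⟨x, c, φ, L, Q, hQ, -, ht, -, hs, hpt⟩ := Sector.chart_spec he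
      obtain ⟨x', c', φ', L', Q', hQ', -, ht', -, hs', -⟩ := Sector.chart_spec he'
      intro v hv
      have hv' : v ∈ e.target ∧ e.symm v ∈ e'.source := by simpa using hv
      obtain ⟨h1, h2⟩ := hs _ (e.map_target hv'.1)
      obtain ⟨h1', h2'⟩ := hs' _ hv'.2
      rw [e.right_inv hv'.1] at h2
      have h3 := c.smooth.contDiffAt_transition hG.manifold_ob c'.smooth h1 h1'
      rw [← h2] at h3
      have h4 : ContDiffAt ℝ ∞ (Q' ∘ (c'.chart ∘ c.chart.symm) ∘ L) v :=
        Q'.contDiff.contDiffAt.comp _ (h3.comp _ L.contDiff.contDiffAt)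
      refine h4.contDiffWithinAt.congr_of_mem (fun w hw => ?_) hv
      have hw' : w ∈ e.target ∧ e.symm w ∈ e'.source := by simpa using hw
      obtain ⟨h5, h6⟩ := hs' _ hw'.2
      simp only [Function.comp_apply]
      rw [← hQ' (e' (e.symm w)), h6, hpt]
    exact ⟨key he he', key he' he⟩

theorem Sector.smooth_pt (hG : G.IsOrbifold) : Smooth (fun s : Sector Γ G => s.pt) := by
  have hS := Sector.isSmoothManifold (Γ := Γ) hG
  refine smooth_iff.2 fun s => ?_
  obtain ⟨d, e, he, hes, hse⟩ := hS.exists_chart s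
  obtain ⟨x, c, φ, L, Q, hQ, -, ht, -, hs, hpt⟩ := Sector.chart_spec he
  refine (smoothAt_iff hS hG.manifold_ob hes c.smooth hse (hs s hse).1).2
    ⟨(Sector.continuous_pt hG).continuousAt, ?_⟩
  have : c.chart ∘ (fun s : Sector Γ G => s.pt) ∘ e.symm = L := by
    ext1 v
    simp only [Function.comp_apply]
    rw [hpt, c.chart.right_inv (by rw [c.target_eq]; trivial)]
  rw [this]
  exact L.contDiff.contDiffAt

/-- The linear left inverse `Q` recovers the coordinates of a sector from those of its base point;
continuity keeps the sectors in one chart. -/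
theorem Sector.smoothAt_of_pt (hG : G.IsOrbifold) {P : Type u} [Atlas P]
    (hP : IsSmoothManifold P) {h : P → Sector Γ G} {p : P} (hc : ContinuousAt h p)
    (hs : SmoothAt (fun p => (h p).pt) p) : SmoothAt h p := by
  have hS := Sector.isSmoothManifold (Γ := Γ) hG
  obtain ⟨d, e, he, hes, hse⟩ := hS.exists_chart (h p)
  obtain ⟨d', a, ha, has, hpa⟩ := hP.exists_chart p
  obtain ⟨x, c, φ, L, Q, hQ, -, ht, -, hse', hpt⟩ := Sector.chart_spec he
  refine (smoothAt_iff hP hS has hes hpa hse).2 ⟨hc, ?_⟩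
  have h1 := ((smoothAt_iff hP hG.manifold_ob has c.smooth hpa (hse' _ hse).1).1 hs).2
  refine (Q.contDiff.contDiffAt.comp _ h1).congr_of_eventuallyEq ?_
  have hca := a.continuousAt_symm (a.map_source hpa)
  rw [ContinuousAt, a.left_inv hpa] at hca
  filter_upwards [hca.eventually (hc.eventually (e.open_source.eventually_mem hse))] with v hv
  simp only [Function.comp_apply]
  rw [← hQ (e _), (hse' _ hv).2]

theorem Sector.smooth_iff (hG : G.IsOrbifold) {P : Type u} [Atlas P] (hP : IsSmoothManifold P)
    {h : P → Sector Γ G} :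
    Smooth h ↔ (∀ γ, Continuous (fun p => Sector.ev γ (h p))) ∧ Smooth (fun p => (h p).pt) := by
  rw [← Sector.continuous_iff hG]
  exact ⟨fun hs => ⟨hs.continuous, (Sector.smooth_pt hG).comp (Sector.isSmoothManifold hG) hs⟩,
    fun hs => OrbifoldSectors.smooth_iff.2 fun p =>
      Sector.smoothAt_of_pt hG hP hs.1.continuousAt (hs.2.smoothAt p)⟩

theorem Sector.smooth_ev (hG : G.IsOrbifold) (γ : Γ) :
    Smooth (Sector.ev γ : Sector Γ G → Arr G.Ob) :=
  hG.smooth_arrow (Sector.continuous_ev hG γ) (Sector.smooth_pt hG)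

end SectorManifold

/-! ### The groupoid of sectors is an orbifold groupoid -/

section SectorArrows

variable {Γ : Type u} [Group Γ] {G : ChartedGroupoid.{u}}

theorem Sector.arrowPair_injective :
    Function.Injective (Sector.arrowPair : Arr (Sector Γ G) → Arr G.Ob × Sector Γ G) := by
  rintro ⟨⟨x, φ⟩, ⟨y, ψ⟩, ⟨g, hg⟩⟩ ⟨⟨x', φ'⟩, ⟨y', ψ'⟩, ⟨g', hg'⟩⟩ h
  obtain ⟨h1, h2⟩ := Prod.mk.inj h
  obtain ⟨h3, h4⟩ := Sector.mk.inj h2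
  obtain ⟨h5, h6, h7⟩ := Arr.mk.inj h1
  dsimp at h3 h4 h6 h7 hg hg'
  subst h3 h6
  obtain rfl := eq_of_heq h4
  obtain rfl := eq_of_heq h7
  obtain rfl := hg.symm.trans hg'
  rfl

theorem Sector.range_arrowPair :
    Set.range (Sector.arrowPair : Arr (Sector Γ G) → Arr G.Ob × Sector Γ G) =
      {p | p.1.src = p.2.pt} := by
  ext ⟨⟨x, y, g⟩, ⟨z, φ⟩⟩
  constructor
  · rintro ⟨a, ha⟩
    obtain ⟨h1, h2⟩ := Prod.mk.inj ha
    change x = z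
    rw [← (Arr.mk.inj h1).1, h2]
  · intro h
    change x = z at h
    subst h
    exact ⟨⟨⟨x, φ⟩, ⟨y, conj g φ⟩, ⟨g, rfl⟩⟩, rfl⟩

theorem Sector.isEmbedding_arrowPair :
    Topology.IsEmbedding (Sector.arrowPair : Arr (Sector Γ G) → Arr G.Ob × Sector Γ G) :=
  ⟨⟨rfl⟩, Sector.arrowPair_injective⟩

/-- The arrow of `G` underlying an arrow of sectors. -/
def Sector.arrow (a : Arr (Sector Γ G)) : Arr G.Ob := ⟨a.src.pt, a.tgt.pt, a.hom.1⟩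

theorem Sector.continuous_arrow :
    Continuous (Sector.arrow : Arr (Sector Γ G) → Arr G.Ob) :=
  continuous_fst.comp Sector.isEmbedding_arrowPair.continuous

variable [Group.FG Γ] (hG : G.IsOrbifold)

include hG

-- This is the base change of the source map of `G` along the anchor map.
omit [Group.FG Γ] in
theorem Sector.isLocalHomeomorph_src :
    IsLocalHomeomorph (fun a : Arr (Sector Γ G) => a.src) :=
  isLocalHomeomorph_baseChange hG.etale_src.isLocalHomeomorph (Sector.continuous_pt hG)
    Sector.isEmbedding_arrowPair Sector.range_arrowPair

theorem Sector.t2_secondCountable_arr :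
    T2Space (Arr (Sector Γ G)) ∧ SecondCountableTopology (Arr (Sector Γ G)) := by
  have := hG.manifold_ar.t2
  have := hG.manifold_ar.secondCountable
  have hS := Sector.isSmoothManifold (Γ := Γ) hG
  have := hS.t2
  have := hS.secondCountable
  exact ⟨Sector.isEmbedding_arrowPair.t2Space,
    Sector.isEmbedding_arrowPair.secondCountableTopology⟩

theorem Sector.isSmoothManifold_arr : IsSmoothManifold (Arr (Sector Γ G)) := by
  obtain ⟨h1, h2⟩ := Sector.t2_secondCountable_arr (Γ := Γ) hG
  exact isSmoothManifold_pullback (Sector.isSmoothManifold hG) (Sector.isLocalHomeomorph_src hG)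

theorem Sector.isLocalDiffeo_src : IsLocalDiffeo (fun a : Arr (Sector Γ G) => a.src) := by
  obtain ⟨h1, h2⟩ := Sector.t2_secondCountable_arr (Γ := Γ) hG
  exact isLocalDiffeo_pullback (Sector.isSmoothManifold hG) (Sector.isLocalHomeomorph_src hG)

theorem Sector.smooth_arrow : Smooth (Sector.arrow : Arr (Sector Γ G) → Arr G.Ob) :=
  hG.smooth_arrow Sector.continuous_arrow ((Sector.smooth_pt hG).comp
    (Sector.isSmoothManifold hG) (Sector.isLocalDiffeo_src hG).smooth)

theorem Sector.smooth_into_arr {P : Type u} [Atlas P] {f : P → Arr (Sector Γ G)}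
    (h1 : Smooth (fun p => Sector.arrow (f p))) (h2 : Smooth (fun p => (f p).src)) :
    Smooth f := by
  refine Smooth.of_localDiffeo_comp (Sector.isSmoothManifold hG) (Sector.isLocalDiffeo_src hG)
    ?_ h2
  rw [Sector.isEmbedding_arrowPair.continuous_iff]
  exact h1.continuous.prodMk h2.continuous

theorem Sector.smooth_tgt : Smooth (fun a : Arr (Sector Γ G) => a.tgt) := by
  have hA := Sector.isSmoothManifold_arr (Γ := Γ) hG
  have hg := Sector.smooth_arrow (Γ := Γ) hG
  refine (Sector.smooth_iff hG hA).2 ⟨fun γ => ?_,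
    hG.submersion_tgt.1.comp hG.manifold_ar hg⟩
  have h1 : Smooth (fun a : Arr (Sector Γ G) => Sector.ev γ a.src) :=
    (Sector.smooth_ev hG γ).comp (Sector.isSmoothManifold hG) (Sector.isLocalDiffeo_src hG).smooth
  -- The evaluation of the target at `γ` is `g φ(γ) g⁻¹`, assembled from smooth families of arrows.
  have h2 := hG.smooth_comp _ hA _ _ _ _ _ h1 hg
  have h3 := hG.smooth_comp _ hA _ _ _ _ _ (hG.smooth_inv.comp hG.manifold_ar hg) h2
  convert h3.continuous using 2 with a
  have hγ : conj a.hom.1 a.src.φ γ = a.tgt.φ γ := DFunLike.congr_fun a.hom.2 γ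
  change (⟨a.tgt.pt, a.tgt.pt, a.tgt.φ γ⟩ : Arr G.Ob) = _
  rw [← hγ]
  rfl

theorem Sector.smooth_inv : Smooth (fun a : Arr (Sector Γ G) =>
    (⟨a.tgt, a.src, Groupoid.inv a.hom⟩ : Arr (Sector Γ G))) :=
  Sector.smooth_into_arr hG (hG.smooth_inv.comp hG.manifold_ar (Sector.smooth_arrow hG))
    (Sector.smooth_tgt hG)

theorem Sector.isLocalDiffeo_tgt : IsLocalDiffeo (fun a : Arr (Sector Γ G) => a.tgt) := by
  refine (Sector.isLocalDiffeo_src hG).comp_involution (Sector.isSmoothManifold_arr hG)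
    (Sector.smooth_inv hG) fun a => ?_
  obtain ⟨s, t, g⟩ := a
  simp

/-- The map remembering the source sector and the endpoints in `G` is proper, being a restriction of
`(s, t) × id` to a closed subset. It factors through the pair of source and target sectors, which
lies in a Hausdorff space. -/
theorem Sector.isProperMap_src_tgt :
    IsProperMap (fun a : Arr (Sector Γ G) => (a.src, a.tgt)) := by
  have := hG.manifold_ob.t2
  have hS := Sector.isSmoothManifold (Γ := Γ) hG
  have := hS.t2
  have hcl : Topology.IsClosedEmbedding
      (Sector.arrowPair : Arr (Sector Γ G) → Arr G.Ob × Sector Γ G) := by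
    refine ⟨Sector.isEmbedding_arrowPair, ?_⟩
    rw [Sector.range_arrowPair]
    exact isClosed_eq (hG.continuous_src.comp continuous_fst)
      ((Sector.continuous_pt hG).comp continuous_snd)
  have h1 := (hG.proper.prodMap (isProperMap_id (X := Sector Γ G))).comp hcl.isProperMap
  let q : Sector Γ G × Sector Γ G → (G.Ob × G.Ob) × Sector Γ G := fun s => ((s.1.pt, s.2.pt), s.1)
  have hq : Continuous q :=
    (((Sector.continuous_pt hG).comp continuous_fst).prodMk
      ((Sector.continuous_pt hG).comp continuous_snd)).prodMk continuous_fst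
  exact isProperMap_of_comp_of_t2
    ((Sector.isLocalDiffeo_src hG).smooth.continuous.prodMk (Sector.smooth_tgt hG).continuous)
    hq h1

theorem sectors_isOrbifold : (sectors Γ G).IsOrbifold where
  manifold_ob := Sector.isSmoothManifold hG
  manifold_ar := Sector.isSmoothManifold_arr hG
  submersion_src := (Sector.isLocalDiffeo_src hG).isSubmersion (Sector.isSmoothManifold hG)
  submersion_tgt := (Sector.isLocalDiffeo_tgt hG).isSubmersion (Sector.isSmoothManifold hG)
  smooth_id := Sector.smooth_into_arr hG
    (hG.smooth_id.comp hG.manifold_ob (Sector.smooth_pt hG))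
    (OrbifoldSectors.smooth_iff.2 (smoothAt_id (Sector.isSmoothManifold hG)))
  smooth_inv := Sector.smooth_inv hG
  smooth_comp P _ hP x y z f g hf hg := by
    have hA := Sector.isSmoothManifold_arr (Γ := Γ) hG
    have h := Sector.smooth_arrow (Γ := Γ) hG
    refine Sector.smooth_into_arr hG ?_
      (Smooth.comp hA (f := fun p => (⟨x p, y p, f p⟩ : Arr (Sector Γ G)))
        (Sector.isLocalDiffeo_src hG).smooth hf)
    exact hG.smooth_comp P hP (fun p => (x p).pt) (fun p => (y p).pt) (fun p => (z p).pt)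
      (fun p => (f p).1) (fun p => (g p).1) (h.comp hA hf) (h.comp hA hg)
  etale_src := Sector.isLocalDiffeo_src hG
  etale_tgt := Sector.isLocalDiffeo_tgt hG
  proper := Sector.isProperMap_src_tgt hG

end SectorArrows

/-! ### The induced homomorphism -/

section SectorsMap

variable {Γ : Type u} [Group Γ] [Group.FG Γ] {G H : ChartedGroupoid.{u}}

theorem isHom_sectorsMap (hG : G.IsOrbifold) (hH : H.IsOrbifold) {F : G.Ob ⥤ H.Ob}
    (hF : IsHom F) : IsHom (sectorsMap Γ F) := by
  have hob : Smooth (fun s : Sector Γ G =>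
      (⟨F.obj s.pt, (F.mapEnd s.pt).comp s.φ⟩ : Sector Γ H)) := by
    refine (Sector.smooth_iff hH (Sector.isSmoothManifold hG)).2 ⟨fun γ => ?_,
      hF.smooth_ob.comp hG.manifold_ob (Sector.smooth_pt hG)⟩
    exact hF.smooth_ar.continuous.comp (Sector.continuous_ev hG γ)
  exact ⟨hob, Sector.smooth_into_arr hH
    (hF.smooth_ar.comp hG.manifold_ar (Sector.smooth_arrow hG))
    (hob.comp (Sector.isSmoothManifold hG) (Sector.isLocalDiffeo_src hG).smooth)⟩

end SectorsMap

/-! ### Submersions and sectors -/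

section Submersion

variable {Γ : Type u} [Group Γ] {G H : ChartedGroupoid.{u}}

/-- Near a point `s.pt`, a homomorphism read in linear charts commutes with the elements of the
images of `s` and of its image. -/
theorem eventually_equivariant (hG : G.IsOrbifold) {F : G.Ob ⥤ H.Ob} (hF : IsHom F)
    {x : G.Ob} (c : LinearChart G x) {x' : H.Ob} (c' : LinearChart H x') {y : G.Ob} (k : End y)
    (hy : y ∈ c.chart.source) (hy' : F.obj y ∈ c'.chart.source) :
    ∀ᶠ v in 𝓝 (c.chart y), c'.chart (F.obj (c.chart.symm (c.rep (c.ξ k) v))) =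
      c'.rep (c'.ξ (F.map k)) (c'.chart (F.obj (c.chart.symm v))) := by
  -- Every point near `y` is the source of an arrow `f` with the label of `k` whose image has the
  -- label of `F.map k`; equivariance of both charts along `f` gives the identity.
  have hO : IsOpen (c.sheet (c.ξ k) ∩ Arr.map F ⁻¹' c'.sheet (c'.ξ (F.map k))) :=
    (c.isOpen_sheet _).inter ((c'.isOpen_sheet _).preimage hF.smooth_ar.continuous)
  have hk : (⟨y, y, k⟩ : Arr G.Ob) ∈
      c.sheet (c.ξ k) ∩ Arr.map F ⁻¹' c'.sheet (c'.ξ (F.map k)) :=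
    ⟨⟨hy, hy, rfl⟩, ⟨hy', hy', rfl⟩⟩
  have hsrc := (hG.etale_src.isLocalHomeomorph.isOpenMap _ hO).eventually_mem
    (Set.mem_image_of_mem _ hk)
  have hc := c.chart.continuousAt_symm (c.chart.map_source hy)
  rw [ContinuousAt, c.chart.left_inv hy] at hc
  filter_upwards [hc.eventually hsrc, c.chart.open_target.eventually_mem (c.chart.map_source hy)]
    with v hv hvt
  obtain ⟨⟨z, w, f⟩, ⟨⟨h1, h2, h3⟩, ⟨h4, h5, h6⟩⟩, hz⟩ := hv
  dsimp [Arr.map] at h1 h2 h3 h4 h5 h6 hz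
  have h7 := c.equivariant h1 h2 f
  have h8 := c'.equivariant h4 h5 (F.map f)
  rw [h3, hz, c.chart.right_inv hvt] at h7
  rw [h6, hz] at h8
  rw [← h7, c.chart.left_inv h2, h8]

theorem fderiv_equivariant {d d' : ℕ} {f : Euc d → Euc d'} {a : Euc d} (R : Euc d →ₗ[ℝ] Euc d)
    (R' : Euc d' →ₗ[ℝ] Euc d') (hf : DifferentiableAt ℝ f a) (ha : R a = a)
    (h : ∀ᶠ v in 𝓝 a, f (R v) = R' (f v)) (v : Euc d) :
    fderiv ℝ f a (R v) = R' (fderiv ℝ f a v) := by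
  let S := LinearMap.toContinuousLinearMap R
  let S' := LinearMap.toContinuousLinearMap R'
  have hS : S a = a := ha
  have h1 : f ∘ S =ᶠ[𝓝 a] S' ∘ f := h
  have h2 : fderiv ℝ (f ∘ S) a = fderiv ℝ (S' ∘ f) a := h1.fderiv_eq
  have hf' : DifferentiableAt ℝ f (S a) := by rwa [hS]
  rw [fderiv_comp (g := f) (f := S) _ hf' S.differentiableAt,
    fderiv_comp (g := S') _ S'.differentiableAt hf, S.fderiv, S'.fderiv, hS] at h2
  exact DFunLike.congr_fun h2 v

/-- An equivariant surjection of representations of a finite group is surjective on invariants. -/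
theorem exists_invariant_preimage {K : Type*} [Group K] [Finite K] {d d' : ℕ}
    (ρ : K →* (Euc d →ₗ[ℝ] Euc d)) (D : Euc d →L[ℝ] Euc d') (hD : Function.Surjective D)
    {w : Euc d'} (hw : ∀ k v, D v = w → D (ρ k v) = w) :
    ∃ v, (∀ k, ρ k v = v) ∧ D v = w := by
  cases nonempty_fintype K
  obtain ⟨v, hv⟩ := hD w
  refine ⟨(Fintype.card K : ℝ)⁻¹ • ∑ k, ρ k v, fun l => ?_, ?_⟩
  · rw [map_smul, map_sum]
    congr 1
    refine Fintype.sum_equiv (Equiv.mulLeft l) _ _ fun k => ?_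
    rw [Equiv.coe_mulLeft, map_mul]
    rfl
  · rw [map_smul, map_sum, Finset.sum_congr rfl fun k _ => hw k v hv]
    simp [← Nat.cast_smul_eq_nsmul ℝ, smul_smul]

variable [Group.FG Γ]

/-- The map on sectors induced by a functor. -/
def Sector.map (F : G.Ob ⥤ H.Ob) (s : Sector Γ G) : Sector Γ H :=
  ⟨F.obj s.pt, (F.mapEnd s.pt).comp s.φ⟩

/-- In charts the map is `Q' ∘ f ∘ L`, with `f` the local form of `F.obj`. The derivative of `f` is
equivariant and onto, hence onto on fixed vectors. -/
theorem Sector.isSubmersion_map (hG : G.IsOrbifold) (hH : H.IsOrbifold) {F : G.Ob ⥤ H.Ob}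
    (hF : IsHom F) (hs : IsSubmersion F.obj) :
    IsSubmersion (Sector.map F : Sector Γ G → Sector Γ H) := by
  have hsm : Smooth (Sector.map F : Sector Γ G → Sector Γ H) :=
    (isHom_sectorsMap hG hH hF).smooth_ob
  refine ⟨hsm, fun d d' e he e' he' s hse hse' => ?_⟩
  have hcont := hsm.continuous
  obtain ⟨x, c, φ, L, Q, hQ, hL, ht, hsrc, hpt, hsymm⟩ := Sector.chart_spec he
  obtain ⟨x', c', φ', L', Q', hQ', hL', ht', hsrc', hpt', -⟩ := Sector.chart_spec he'
  obtain ⟨h1, h2⟩ := hpt s hse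
  obtain ⟨h1', -⟩ := hpt' _ hse'
  change F.obj s.pt ∈ c'.chart.source at h1'
  rw [hsrc] at hse
  rw [hsrc'] at hse'
  have hξ := ((c.mem_range_kappa φ).1 hse).2
  have hξ' : ∀ γ, c'.ξ (F.map (s.φ γ)) = φ' γ := ((c'.mem_range_kappa φ').1 hse').2
  have hfix : ∀ γ, c.rep (φ γ) (c.chart s.pt) = c.chart s.pt := by
    have := (hL (c.chart s.pt)).2 ⟨_, h2⟩
    exact this
  rw [← hsrc] at hse
  rw [← hsrc'] at hse'
  let f : Euc c.dim → Euc c'.dim := c'.chart ∘ F.obj ∘ c.chart.symm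
  have hsub := isSubmersion_iff.1 hs s.pt
  have hfd : DifferentiableAt ℝ f (c.chart s.pt) :=
    ((smoothAt_iff hG.manifold_ob hH.manifold_ob c.smooth c'.smooth h1 h1').1
      hsub.1).2.differentiableAt (by simp)
  have hsurj : Function.Surjective (fderiv ℝ f (c.chart s.pt)) :=
    ((submersionAt_iff hG.manifold_ob hH.manifold_ob c.smooth c'.smooth h1 h1').1 hsub).2
  have hequiv : ∀ γ v, fderiv ℝ f (c.chart s.pt) (c.rep (φ γ) v) =
      c'.rep (φ' γ) (fderiv ℝ f (c.chart s.pt) v) := fun γ v => by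
    refine fderiv_equivariant _ _ hfd (hfix γ) ?_ v
    rw [← hξ γ, ← hξ' γ]
    exact eventually_equivariant hG hF c c' (s.φ γ) h1 h1'
  have heq : e' ∘ Sector.map F ∘ e.symm =ᶠ[𝓝 (e s)] Q' ∘ f ∘ L := by
    have hc := e.continuousAt_symm (e.map_source hse)
    rw [ContinuousAt, e.left_inv hse] at hc
    filter_upwards [hc.eventually
      (hcont.continuousAt.eventually (e'.open_source.eventually_mem hse'))] with v hv
    have h3 := (hpt' _ hv).2
    change L' _ = c'.chart (F.obj (e.symm v).pt) at h3
    rw [hsymm] at h3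
    simp only [Function.comp_apply, f]
    rw [← h3, hQ']
  rw [heq.fderiv_eq]
  rw [← h2] at hfd hsurj hequiv
  rw [fderiv_comp (g := Q') (f := f ∘ L) _ Q'.differentiableAt
    (hfd.comp _ L.differentiableAt), fderiv_comp (g := f) _ hfd L.differentiableAt, Q'.fderiv,
    L.fderiv]
  intro w
  have hw : ∀ γ, c'.rep (φ' γ) (L' w) = L' w := (hL' (L' w)).2 ⟨w, rfl⟩
  have := hG.finite_isotropy x
  -- Averaging is over the image of `Γ`, since `Γ` itself may be infinite.
  have : Finite φ.range := Subtype.finite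
  obtain ⟨v, hv, hDv⟩ := exists_invariant_preimage (K := φ.range)
    ((c.rep : End x →* (Euc c.dim →ₗ[ℝ] Euc c.dim)).comp φ.range.subtype) _ hsurj (w := L' w) (by
      rintro ⟨_, γ, rfl⟩ v hv
      change fderiv ℝ f (L (e s)) (c.rep (φ γ) v) = L' w
      rw [hequiv, hv, hw])
  obtain ⟨u, rfl⟩ := (hL v).1 fun γ => hv ⟨φ γ, γ, rfl⟩
  refine ⟨u, ?_⟩
  change Q' (fderiv ℝ f (L (e s)) (L u)) = w
  rw [hDv, hQ']

theorem isSubmersion_sectorsMap (hG : G.IsOrbifold) (hH : H.IsOrbifold) {F : G.Ob ⥤ H.Ob}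
    (hF : IsHom F) (hs : IsSubmersion F.obj) : IsSubmersion (sectorsMap Γ F).obj :=
  Sector.isSubmersion_map hG hH hF hs

end Submersion

/-! ### Equivalences -/

section Equivalence

variable {Γ : Type u} [Group Γ] {G H : ChartedGroupoid.{u}} {F : G.Ob ⥤ H.Ob}

theorem IsFibredProduct.existsUnique (hF : IsFibredProduct F) {x y : G.Ob}
    (h : F.obj x ⟶ F.obj y) : ∃! g : x ⟶ y, F.map g = h := by
  let _ : Atlas PUnit.{u + 1} := pointAtlas
  obtain ⟨g, ⟨-, hg⟩, hu⟩ := hF PUnit.{u + 1} isSmoothManifold_point (fun _ => x) (fun _ => y)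
    (fun _ => h) (smooth_from_point _) (smooth_from_point _) (smooth_from_point _)
  exact ⟨g PUnit.unit, hg _, fun g' hg' =>
    congrFun (hu (fun _ => g') ⟨smooth_from_point _, fun _ => hg'⟩) PUnit.unit⟩

theorem IsFibredProduct.faithful (hF : IsFibredProduct F) : F.Faithful where
  map_injective {_ _ _ g} h := (hF.existsUnique (F.map g)).unique h rfl

theorem IsFibredProduct.full (hF : IsFibredProduct F) : F.Full where
  map_surjective h := (hF.existsUnique h).exists

/-- Homomorphisms into isotropy groups lift along equivalences. -/
theorem IsFibredProduct.exists_lift (hF : IsFibredProduct F) {x : G.Ob}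
    (ψ : Γ →* End (F.obj x)) : ∃ φ : Γ →* End x, (F.mapEnd x).comp φ = ψ := by
  have := hF.faithful
  have := hF.full
  let E := (Functor.FullyFaithful.ofFullyFaithful F).mulEquivEnd x
  refine ⟨E.symm.toMonoidHom.comp ψ, ?_⟩
  ext γ
  exact E.apply_symm_apply (ψ γ)

/-- The underlying arrows lift by the fibred product property of `F`. That the lifts conjugate one
sector into the other can be checked after applying `F`, which is faithful. -/
theorem isFibredProduct_sectorsMap [Group.FG Γ] (hG : G.IsOrbifold) (hH : H.IsOrbifold)
    (hF : IsFibredProduct F) : IsFibredProduct (sectorsMap Γ F) := by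
  intro P _ hP x y h hx hy hh
  have hfaith := hF.faithful
  change P → Sector Γ G at x y
  have hpt : Smooth (fun s : Sector Γ G => s.pt) := Sector.smooth_pt hG
  have hS : IsSmoothManifold (Sector Γ G) := Sector.isSmoothManifold hG
  obtain ⟨g, ⟨hg1, hg2⟩, -⟩ := hF P hP (fun p => (x p).pt) (fun p => (y p).pt)
    (fun p => (h p).1) (hpt.comp hS hx) (hpt.comp hS hy)
    ((Sector.smooth_arrow hH).comp (Sector.isSmoothManifold_arr hH) hh)
  have hconj : ∀ p, conj (g p) (x p).φ = (y p).φ := by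
    intro p
    ext γ
    apply F.map_injective
    have h1 := (h p).2
    rw [← hg2 p] at h1
    have h2 := (conj_map F (g p) (x p).φ).symm.trans h1
    exact DFunLike.congr_fun h2 γ
  refine ⟨fun p => ⟨g p, hconj p⟩, ⟨?_, fun p => Subtype.ext (hg2 p)⟩, fun g' hg' => ?_⟩
  · exact Sector.smooth_into_arr hG hg1 hx
  · funext p
    apply Subtype.ext
    apply F.map_injective
    exact (congrArg Subtype.val (hg'.2 p)).trans (hg2 p).symm

/-- For étale groupoids, the submersion condition on equivalences says that the map on objects
is a submersion. -/
theorem isSubmersion_tgt_arrowsFrom_iff (hG : G.IsOrbifold) (hH : H.IsOrbifold) (hF : IsHom F) :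
    IsSubmersion (fun p : ArrowsFrom F => p.1.1.tgt) ↔ IsSubmersion F.obj := by
  have := hH.manifold_ar.t2
  have := hH.manifold_ar.secondCountable
  have := hG.manifold_ob.t2
  have := hG.manifold_ob.secondCountable
  have hemb : Topology.IsEmbedding (fun p : ArrowsFrom F => p.1) :=
    ⟨⟨rfl⟩, Subtype.val_injective⟩
  have := hemb.t2Space
  have := hemb.secondCountableTopology
  have hloc : IsLocalHomeomorph (fun p : ArrowsFrom F => p.1.2) :=
    isLocalHomeomorph_baseChange hH.etale_src.isLocalHomeomorph hF.smooth_ob.continuous hemb (by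
      ext p
      exact ⟨fun ⟨q, hq⟩ => hq ▸ q.2, fun hp => ⟨⟨p, hp⟩, rfl⟩⟩)
  have hA : IsSmoothManifold (ArrowsFrom F) := isSmoothManifold_pullback hG.manifold_ob hloc
  have hd : IsLocalDiffeo (fun p : ArrowsFrom F => p.1.2) :=
    isLocalDiffeo_pullback hG.manifold_ob hloc
  have hc : Continuous (fun p : ArrowsFrom F => p.1.1) := continuous_fst.comp hemb.continuous
  have hcomp : (fun a : Arr H.Ob => a.src) ∘ (fun p : ArrowsFrom F => p.1.1) =
      F.obj ∘ (fun p : ArrowsFrom F => p.1.2) := by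
    ext p
    exact p.2
  rw [isSubmersion_iff, isSubmersion_iff]
  constructor
  · intro h x
    -- At the unit arrow over `x`, étaleness of the target map shows that the first projection is a
    -- submersion. Followed by the source map it equals `F.obj` after the second projection, and the
    -- claim passes to the outer factor.
    let p : ArrowsFrom F := ⟨(⟨F.obj x, F.obj x, 𝟙 _⟩, x), rfl⟩
    have h1 : SubmersionAt (fun p : ArrowsFrom F => p.1.1) p :=
      SubmersionAt.of_localDiffeo_comp hH.manifold_ar hH.manifold_ob hH.etale_tgt
        hc.continuousAt (h p)
    have h2 : SubmersionAt ((fun a : Arr H.Ob => a.src) ∘ (fun p : ArrowsFrom F => p.1.1)) p :=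
      SubmersionAt.comp hH.manifold_ar (hH.etale_src.submersionAt hH.manifold_ob _) h1
    rw [hcomp] at h2
    exact h2.of_comp hA (hF.smooth_ob.smoothAt _) (hd.smooth.smoothAt p)
  · intro h p
    have h1 : SubmersionAt ((fun a : Arr H.Ob => a.src) ∘ (fun p : ArrowsFrom F => p.1.1)) p := by
      rw [hcomp]
      exact SubmersionAt.comp hG.manifold_ob (h _) (hd.submersionAt hG.manifold_ob p)
    have h2 := SubmersionAt.of_localDiffeo_comp hH.manifold_ar hH.manifold_ob hH.etale_src
      hc.continuousAt h1
    exact SubmersionAt.comp hH.manifold_ar (g := fun a : Arr H.Ob => a.tgt)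
      (hH.etale_tgt.submersionAt hH.manifold_ob _) h2

theorem IsEquivalence.sectorsMap [Group.FG Γ] (hG : G.IsOrbifold) (hH : H.IsOrbifold)
    (hF : IsEquivalence F) : IsEquivalence (sectorsMap Γ F) := by
  have hhom := isHom_sectorsMap (Γ := Γ) hG hH hF.toIsHom
  refine { hhom with
    surjective := ?_
    submersion := ?_
    fibredProduct := isFibredProduct_sectorsMap hG hH hF.fibredProduct }
  · rintro ⟨y, ψ⟩
    obtain ⟨⟨⟨⟨z, y', h⟩, x⟩, hp⟩, hy⟩ := hF.surjective y
    dsimp at hp hy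
    subst hp hy
    -- Conjugating back along `h` moves `ψ` into the isotropy group of `F.obj x`, where it lifts.
    obtain ⟨φ, hφ⟩ := hF.fibredProduct.exists_lift (conj (Groupoid.inv h) ψ)
    have hψ : conj h ((F.mapEnd x).comp φ) = ψ := by
      rw [hφ, ← conj_comp, Groupoid.inv_comp, conj_id]
    exact ⟨⟨(⟨(⟨F.obj x, (F.mapEnd x).comp φ⟩ : Sector Γ H), (⟨_, ψ⟩ : Sector Γ H), ⟨h, hψ⟩⟩,
      (⟨x, φ⟩ : Sector Γ G)), rfl⟩, rfl⟩
  · refine (isSubmersion_tgt_arrowsFrom_iff (sectors_isOrbifold hG) (sectors_isOrbifold hH)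
      hhom).2 (isSubmersion_sectorsMap hG hH hF.toIsHom ?_)
    exact (isSubmersion_tgt_arrowsFrom_iff hG hH hF.toIsHom).1 hF.submersion

theorem IsStrongEquivalence.sectorsMap [Group.FG Γ] (hG : G.IsOrbifold) (hH : H.IsOrbifold)
    (hF : IsStrongEquivalence F) : IsStrongEquivalence (sectorsMap Γ F) := by
  refine { isHom_sectorsMap (Γ := Γ) hG hH hF.toIsHom with
    surjective := ?_
    submersion := isSubmersion_sectorsMap hG hH hF.toIsHom hF.submersion
    fibredProduct := isFibredProduct_sectorsMap hG hH hF.fibredProduct }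
  rintro ⟨y, ψ⟩
  obtain ⟨x, rfl⟩ := hF.surjective y
  obtain ⟨φ, rfl⟩ := hF.fibredProduct.exists_lift ψ
  exact ⟨(⟨x, φ⟩ : Sector Γ G), rfl⟩

end Equivalence

/-! ### Orbit spaces -/

section Orbits

variable {G H : ChartedGroupoid.{u}}

theorem ChartedGroupoid.orbit_eq_iff {x y : G.Ob} :
    G.orbit x = G.orbit y ↔ Nonempty (x ⟶ y) := by
  refine Quotient.eq.trans ⟨fun ⟨i⟩ => ⟨i.hom⟩, fun ⟨f⟩ => ⟨asIso f⟩⟩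

theorem ChartedGroupoid.continuous_orbit : Continuous G.orbit := continuous_quotient_mk'

/-- The saturation of `U` is `t (s⁻¹ U)`, and the étale target map is open. -/
theorem ChartedGroupoid.IsOrbifold.isOpenMap_orbit (hG : G.IsOrbifold) : IsOpenMap G.orbit := by
  intro U hU
  change IsOpen (G.orbit ⁻¹' (G.orbit '' U))
  have : G.orbit ⁻¹' (G.orbit '' U) =
      (fun a : Arr G.Ob => a.tgt) '' ((fun a : Arr G.Ob => a.src) ⁻¹' U) := by
    ext y
    constructor
    · rintro ⟨x, hx, hxy⟩
      obtain ⟨f⟩ := ChartedGroupoid.orbit_eq_iff.1 hxy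
      exact ⟨⟨x, y, f⟩, hx, rfl⟩
    · rintro ⟨⟨x, y, f⟩, hx, rfl⟩
      exact ⟨x, hx, ChartedGroupoid.orbit_eq_iff.2 ⟨f⟩⟩
  rw [this]
  exact hG.etale_tgt.isLocalHomeomorph.isOpenMap _ (hU.preimage hG.continuous_src)

/-- An equivalence of orbifold groupoids induces a homeomorphism of orbit spaces. -/
theorem IsEquivalence.exists_homeomorph (hG : G.IsOrbifold) (hH : H.IsOrbifold)
    {F : G.Ob ⥤ H.Ob} (hF : IsEquivalence F) :
    ∃ f : G.OrbitSpace ≃ₜ H.OrbitSpace, ∀ x, f (G.orbit x) = H.orbit (F.obj x) := by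
  let q : G.OrbitSpace → H.OrbitSpace := Quotient.lift (fun x => H.orbit (F.obj x))
    fun x y ⟨i⟩ => ChartedGroupoid.orbit_eq_iff.2 ⟨F.map i.hom⟩
  have hq : ∀ x, q (G.orbit x) = H.orbit (F.obj x) := fun x => rfl
  have hcont : Continuous q :=
    (ChartedGroupoid.continuous_orbit.comp hF.smooth_ob.continuous).quotient_lift _
  have hopen : IsOpenMap q := by
    intro U hU
    have hsub := (isSubmersion_tgt_arrowsFrom_iff hG hH hF.toIsHom).1 hF.submersion
    have := hH.isOpenMap_orbit _ (hsub.isOpenMap hG.manifold_ob hH.manifold_ob _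
      (hU.preimage ChartedGroupoid.continuous_orbit))
    convert this using 1
    ext z
    constructor
    · rintro ⟨o, ho, rfl⟩
      obtain ⟨x, rfl⟩ := Quotient.exists_rep o
      exact ⟨F.obj x, ⟨x, ho, rfl⟩, rfl⟩
    · rintro ⟨_, ⟨x, hx, rfl⟩, rfl⟩
      exact ⟨G.orbit x, hx, rfl⟩
  have hbij : Function.Bijective q := by
    constructor
    · intro o o' h
      obtain ⟨x, rfl⟩ := Quotient.exists_rep o
      obtain ⟨y, rfl⟩ := Quotient.exists_rep o'
      obtain ⟨f⟩ := ChartedGroupoid.orbit_eq_iff.1 h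
      exact ChartedGroupoid.orbit_eq_iff.2 ⟨(hF.fibredProduct.existsUnique f).choose⟩
    · intro o
      obtain ⟨y, rfl⟩ := Quotient.exists_rep o
      obtain ⟨⟨⟨⟨z, y', h⟩, x⟩, hp⟩, rfl⟩ := hF.surjective y
      dsimp at hp
      subst hp
      exact ⟨G.orbit x, ChartedGroupoid.orbit_eq_iff.2 ⟨h⟩⟩
  exact ⟨(Equiv.ofBijective q hbij).toHomeomorphOfContinuousOpen hcont hopen, fun x => rfl⟩

/-- Morita equivalent orbifold groupoids have isomorphic orbifolds of sectors. -/
theorem MoritaEquivalent.exists_isOrbifoldIso_sectors {Γ : Type u} [Group Γ] [Group.FG Γ]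
    (hG : G.IsOrbifold) (hH : H.IsOrbifold) (h : MoritaEquivalent G H) :
    ∃ f : (sectors Γ G).OrbitSpace ≃ₜ (sectors Γ H).OrbitSpace, IsOrbifoldIso f := by
  obtain ⟨K, hK, E, D, hE, hD⟩ := h
  have hE' := hE.sectorsMap (Γ := Γ) hK hG
  have hD' := hD.sectorsMap (Γ := Γ) hK hH
  have hK' := sectors_isOrbifold (Γ := Γ) hK
  obtain ⟨e, he⟩ := hE'.exists_homeomorph hK' (sectors_isOrbifold hG)
  obtain ⟨d, hd⟩ := hD'.exists_homeomorph hK' (sectors_isOrbifold hH)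
  -- The sectors of the middle groupoid serve as the span, and the homeomorphism is `|D_*| ∘
  -- |E_*|⁻¹`.
  refine ⟨e.symm.trans d, sectors Γ K, hK', _, _, hE', hD', fun k => ?_⟩
  rw [← he, Homeomorph.trans_apply, Homeomorph.symm_apply_apply, hd]

end Orbits

end OrbifoldSectors

theorem mainTheorem4 {Γ : Type u} [Group Γ] [Group.FG Γ]
    (G H : OrbifoldSectors.ChartedGroupoid.{u}) (hG : G.IsOrbifold) (hH : H.IsOrbifold) :
    ((OrbifoldSectors.sectors Γ G).IsOrbifold ∧ (OrbifoldSectors.sectors Γ H).IsOrbifold) ∧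
    (∀ F : G.Ob ⥤ H.Ob, OrbifoldSectors.IsHom F →
      OrbifoldSectors.IsHom (OrbifoldSectors.sectorsMap Γ F)) ∧
    (∀ F : G.Ob ⥤ H.Ob, OrbifoldSectors.IsStrongEquivalence F →
      OrbifoldSectors.IsStrongEquivalence (OrbifoldSectors.sectorsMap Γ F)) ∧
    (OrbifoldSectors.MoritaEquivalent G H →
      ∃ f : (OrbifoldSectors.sectors Γ G).OrbitSpace ≃ₜ (OrbifoldSectors.sectors Γ H).OrbitSpace,
        OrbifoldSectors.IsOrbifoldIso f) :=
  ⟨⟨OrbifoldSectors.sectors_isOrbifold hG, OrbifoldSectors.sectors_isOrbifold hH⟩,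
    fun _ hF => OrbifoldSectors.isHom_sectorsMap hG hH hF,
    fun _ hF => hF.sectorsMap hG hH,
    fun h => h.exists_isOrbifoldIso_sectors hG hH⟩
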